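/- A \emph{C*-ternary ring} is a complex Banach space $M$ with a triple product $[\cdot\,\cdot\,\cdot]:M\times M\times M\to M$ which is linear in the outer variables and conjugate-linear in the middle one and satisfies $[[xyz]uv]=[x[uzy]v]=[xy[zuv]]$, $\|[xyz]\|\le\|x\|\|y\|\|z\|$ and $\|[xxx]\|=\|x\|^3$. A \emph{closed ideal} of $M$ is a closed linear subspace $I$ with $[MMI]\subset I$, $[IMM]\subset I$ and $[MIM]\subset I$; with the restricted operations it is itself a C*-ternary ring. Let $E(M)=B(M)\oplus\overline{B(M)}^{\,op}$, with $(A_1,A_2)(B_1,B_2)=(A_1B_1,B_2A_2)$, involution $\overline{(A_1,A_2)}=(A_2,A_1)$, scalar action $\lambda(A_1,A_2)=(\lambda A_1,\bar\lambda A_2)$ and norm $\max(\|A_1\|,\|A_2\|)$. For $x,y\in M$ put $\ell(x,y)=([xy\,\cdot],[yx\,\cdot])$ and $r(x,y)=([\cdot\,xy],[\cdot\,yx])$. Let $L(M)\subset E(M)$ be the closed linear span of the elements $\ell(x,y)$, and let $R(M)\subset E(M)^{op}$ be the closed linear span of the elements $r(x,y)$; $\circ$ denotes the product of $E(M)^{op}$.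 The \emph{normed standard embedding} of $M$ is the *-algebra $$\mathcal A(M)=\begin{bmatrix}L(M)&M\\ \overline M&R(M)\end{bmatrix},\qquad \begin{bmatrix}A&f\\ \overline g&B\end{bmatrix}\begin{bmatrix}A'&f'\\ \overline{g'}&B'\end{bmatrix}=\begin{bmatrix}AA'+\ell(f,g')&A_1f'+B'_1f\\ \overline{A'_2g+B_2g'}&r(g,f')+B\circ B'\end{bmatrix},\qquad \begin{bmatrix}A&f\\ \overline g&B\end{bmatrix}^{\#}=\begin{bmatrix}\overline A&g\\ \overline f&\overline B\end{bmatrix},$$ where $\overline M$ is the conjugate space of $M$. The norm of $a=\begin{bmatrix}A&f\\ \overline g&B\end{bmatrix}$ is the operator norm of $(f',B')\mapsto(A_1f'+B'_1f,\ r(g,f')+B\circ B')$ on $M\oplus R(M)$ normed by $(\|f'\|^2+\|B'\|^2)^{1/2}$. \textbf{Proposition.} Let $I$ be a closed ideal in a C*-ternary ring $M$. Then $\mathcal A(I)$ is a closed ideal in $\mathcal A(M)$. Precisely, there is a *-homomorphism $\varphi:\mathcal A(I)\to\mathcal A(M)$ which is a homeomorphism onto its image, which satisfies $$\varphi\begin{bmatrix}\ell(x,y)&f\\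 \overline g&r(u,v)\end{bmatrix}=\begin{bmatrix}\ell(x,y)&f\\ \overline g&r(u,v)\end{bmatrix}\qquad(x,y,f,g,u,v\in I)$$ (where $\ell,r$ are formed in $I$ on the left and in $M$ on the right), and whose image is a closed two-sided ideal of $\mathcal A(M)$. -/

import Mathlib

noncomputable section

/-! ### C*-ternary rings -/

/-- A C*-ternary ring: a complex Banach space with a triple product `[x y z]`, linear in the outer
variables and conjugate-linear in the middle one, satisfying
`[[xyz]uv] = [x[uzy]v] = [xy[zuv]]`, `‖[xyz]‖ ≤ ‖x‖‖y‖‖z‖` and `‖[xxx]‖ = ‖x‖ ^ 3`. -/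
class CStarTernaryRing (M : Type*) [NormedAddCommGroup M] [NormedSpace ℂ M] extends
    CompleteSpace M where
  triple : M → M → M → M
  triple_add_left : ∀ x x' y z, triple (x + x') y z = triple x y z + triple x' y z
  triple_smul_left : ∀ (c : ℂ) x y z, triple (c • x) y z = c • triple x y z
  triple_add_mid : ∀ x y y' z, triple x (y + y') z = triple x y z + triple x y' z
  triple_smul_mid : ∀ (c : ℂ) x y z, triple x (c • y) z = starRingEnd ℂ c • triple x y z
  triple_add_right : ∀ x y z z', triple x y (z + z') = triple x y z + triple x y z'
  triple_smul_right : ∀ (c : ℂ) x y z, triple x y (c • z) = c • triple x y z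
  triple_assoc_mid : ∀ x y z u v, triple (triple x y z) u v = triple x (triple u z y) v
  triple_assoc : ∀ x y z u v, triple (triple x y z) u v = triple x y (triple z u v)
  norm_triple_le : ∀ x y z, ‖triple x y z‖ ≤ ‖x‖ * ‖y‖ * ‖z‖
  norm_triple_self : ∀ x, ‖triple x x x‖ = ‖x‖ ^ 3

namespace CStarTernary

open CStarTernaryRing

/-! ### The conjugate of a complex normed space -/

/-- The complex conjugate of a complex normed space: the same additive group and norm, with the
scalar action twisted by complex conjugation. -/
def ConjSpace (V : Type*) : Type _ := V

section ConjSpace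

variable {V : Type*} [NormedAddCommGroup V] [NormedSpace ℂ V]

instance : NormedAddCommGroup (ConjSpace V) := inferInstanceAs (NormedAddCommGroup V)

instance : Module ℂ (ConjSpace V) :=
  (Module.compHom V (starRingEnd ℂ) : Module ℂ V)

instance : NormedSpace ℂ (ConjSpace V) where
  norm_smul_le c v := by
    have h : ‖(starRingEnd ℂ c) • (show V from v)‖ ≤ ‖c‖ * ‖(show V from v)‖ := by
      rw [norm_smul, RCLike.norm_conj]
    exact h

/-- The canonical conjugate-linear isometry `v ↦ v̄`. -/
def conj : V ≃ₗᵢ⋆[ℂ] ConjSpace V where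
  toFun v := v
  invFun v := v
  left_inv _ := rfl
  right_inv _ := rfl
  map_add' _ _ := rfl
  map_smul' c v := by
    change c • v = (starRingEnd ℂ (starRingEnd ℂ c)) • v
    rw [Complex.conj_conj]
  norm_map' _ := rfl

theorem conj_smul (c : ℂ) (v : V) : conj (c • v) = starRingEnd ℂ c • conj v :=
  conj.map_smulₛₗ c v

theorem conj_symm_smul (c : ℂ) (v : ConjSpace V) :
    conj.symm (c • v) = starRingEnd ℂ c • conj.symm v := rfl

end ConjSpace

variable {M : Type*} [NormedAddCommGroup M] [NormedSpace ℂ M] [CStarTernaryRing M]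

/-! ### Multiplication operators -/

/-- `[x y ·]` as a bounded operator. -/
def opL (x y : M) : M →L[ℂ] M :=
  LinearMap.mkContinuous
    { toFun := fun z => triple x y z
      map_add' := triple_add_right x y
      map_smul' := fun c z => triple_smul_right c x y z }
    (‖x‖ * ‖y‖) (norm_triple_le x y)

/-- `[· y z]` as a bounded operator. -/
def opR (y z : M) : M →L[ℂ] M :=
  LinearMap.mkContinuous
    { toFun := fun x => triple x y z
      map_add' := fun x x' => triple_add_left x x' y z
      map_smul' := fun c x => triple_smul_left c x y z }
    (‖y‖ * ‖z‖) (fun x => (norm_triple_le x y z).trans_eq (by ring))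

/-- `[x · z]` as a bounded conjugate-linear operator. -/
def opM (x z : M) : M →L⋆[ℂ] M :=
  LinearMap.mkContinuous
    { toFun := fun y => triple x y z
      map_add' := fun y y' => triple_add_mid x y y' z
      map_smul' := fun c y => triple_smul_mid c x y z }
    (‖x‖ * ‖z‖) (fun y => (norm_triple_le x y z).trans_eq (by ring))

@[simp] theorem opL_apply (x y z : M) : opL x y z = triple x y z := rfl
@[simp] theorem opR_apply (x y z : M) : opR y z x = triple x y z := rfl
@[simp] theorem opM_apply (x y z : M) : opM x z y = triple x y z := rfl

theorem norm_opL_le (x y : M) : ‖opL x y‖ ≤ ‖x‖ * ‖y‖ :=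
  LinearMap.mkContinuous_norm_le _ (by positivity) _

theorem norm_opR_le (y z : M) : ‖opR y z‖ ≤ ‖y‖ * ‖z‖ :=
  LinearMap.mkContinuous_norm_le _ (by positivity) _

theorem eq_zero_of_triple_self {x : M} (h : triple x x x = 0) : x = 0 := by
  have h1 := norm_triple_self x
  rw [h, norm_zero] at h1
  exact norm_eq_zero.1 (pow_eq_zero_iff (n := 3) (by norm_num) |>.1 h1.symm)

/-! ### The *-algebra `E(M)` -/

/-- The space underlying `E(M)`, namely the direct sum of `B(M)` and of the conjugate of
`B(M)` (with the opposite product), normed by `‖(A₁, A₂)‖ = max ‖A₁‖ ‖A₂‖`. -/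
def EndPair (M : Type*) [NormedAddCommGroup M] [NormedSpace ℂ M] : Type _ :=
  (M →L[ℂ] M) × ConjSpace (M →L[ℂ] M)

instance (N : Type*) [NormedAddCommGroup N] [NormedSpace ℂ N] : NormedAddCommGroup (EndPair N) :=
  inferInstanceAs (NormedAddCommGroup ((N →L[ℂ] N) × ConjSpace (N →L[ℂ] N)))

instance (N : Type*) [NormedAddCommGroup N] [NormedSpace ℂ N] : NormedSpace ℂ (EndPair N) :=
  inferInstanceAs (NormedSpace ℂ ((N →L[ℂ] N) × ConjSpace (N →L[ℂ] N)))

namespace EndPair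

variable {N : Type*} [NormedAddCommGroup N] [NormedSpace ℂ N]

/-- The pair `(A₁, A₂)`. -/
def mk (a b : N →L[ℂ] N) : EndPair N := (a, conj b)

/-- The component `A₁` of `A = (A₁, A₂)`. -/
def one (A : EndPair N) : N →L[ℂ] N := A.1

/-- The component `A₂` of `A = (A₁, A₂)`. -/
def two (A : EndPair N) : N →L[ℂ] N := conj.symm A.2

/-- The product `(A₁, A₂)(B₁, B₂) = (A₁B₁, B₂A₂)` of `E(M)`. -/
def mul (A B : EndPair N) : EndPair N := mk (A.one ∘L B.one) (B.two ∘L A.two)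

/-- The involution `(A₁, A₂) ↦ (A₂, A₁)` of `E(M)`. -/
def inv (A : EndPair N) : EndPair N := mk A.two A.one

@[simp] theorem one_mk (a b : N →L[ℂ] N) : (mk a b).one = a := rfl
@[simp] theorem two_mk (a b : N →L[ℂ] N) : (mk a b).two = b := rfl
@[simp] theorem one_add (A B : EndPair N) : (A + B).one = A.one + B.one := rfl
@[simp] theorem two_add (A B : EndPair N) : (A + B).two = A.two + B.two := rfl
@[simp] theorem one_zero : (0 : EndPair N).one = 0 := rfl
@[simp] theorem two_zero : (0 : EndPair N).two = 0 := rfl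
@[simp] theorem one_smul (c : ℂ) (A : EndPair N) : (c • A).one = c • A.one := rfl
@[simp] theorem two_smul (c : ℂ) (A : EndPair N) :
    (c • A).two = starRingEnd ℂ c • A.two := rfl
@[simp] theorem one_mul (A B : EndPair N) : (mul A B).one = A.one ∘L B.one := rfl
@[simp] theorem two_mul (A B : EndPair N) : (mul A B).two = B.two ∘L A.two := rfl
@[simp] theorem one_inv (A : EndPair N) : (inv A).one = A.two := rfl
@[simp] theorem two_inv (A : EndPair N) : (inv A).two = A.one := rfl

theorem ext {A B : EndPair N} (h₁ : ∀ x, A.one x = B.one x) (h₂ : ∀ x, A.two x = B.two x) :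
    A = B :=
  Prod.ext (ContinuousLinearMap.ext h₁) (ContinuousLinearMap.ext h₂)

theorem norm_mk (a b : N →L[ℂ] N) : ‖mk a b‖ = max ‖a‖ ‖b‖ := rfl

theorem norm_one_le (A : EndPair N) : ‖A.one‖ ≤ ‖A‖ := le_max_left _ _

theorem norm_two_le (A : EndPair N) : ‖A.two‖ ≤ ‖A‖ := le_max_right _ _

theorem norm_mul_le (A B : EndPair N) : ‖mul A B‖ ≤ ‖A‖ * ‖B‖ := by
  refine max_le ?_ ?_
  · exact (ContinuousLinearMap.opNorm_comp_le _ _).trans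
      (mul_le_mul A.norm_one_le B.norm_one_le (norm_nonneg _) (norm_nonneg _))
  · refine (ContinuousLinearMap.opNorm_comp_le B.two A.two).trans ?_
    rw [mul_comm]
    exact mul_le_mul A.norm_two_le B.norm_two_le (norm_nonneg _) (norm_nonneg _)

@[fun_prop]
theorem continuous_one : Continuous (one : EndPair N → _) := continuous_fst

@[fun_prop]
theorem continuous_two : Continuous (two : EndPair N → _) :=
  (conj (V := N →L[ℂ] N)).symm.continuous.comp continuous_snd

@[fun_prop]
theorem continuous_one_apply (x : N) : Continuous fun A : EndPair N => A.one x :=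
  (ContinuousLinearMap.apply ℂ N x).continuous.comp continuous_one

@[fun_prop]
theorem continuous_two_apply (x : N) : Continuous fun A : EndPair N => A.two x :=
  (ContinuousLinearMap.apply ℂ N x).continuous.comp continuous_two

theorem continuous_mk : Continuous fun p : (N →L[ℂ] N) × (N →L[ℂ] N) => mk p.1 p.2 :=
  continuous_fst.prodMk ((conj (V := N →L[ℂ] N)).continuous.comp continuous_snd)

theorem continuous_inv : Continuous (inv : EndPair N → _) :=
  continuous_mk.comp (continuous_two.prodMk continuous_one)

theorem continuous_mul_left (A : EndPair N) : Continuous fun B : EndPair N => mul A B :=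
  continuous_mk.comp ((continuous_const.clm_comp continuous_one).prodMk
    (continuous_two.clm_comp continuous_const))

theorem continuous_mul_right (A : EndPair N) : Continuous fun B : EndPair N => mul B A :=
  continuous_mk.comp ((continuous_one.clm_comp continuous_const).prodMk
    (continuous_const.clm_comp continuous_two))

theorem closure_span_induction {S : Set (EndPair N)} {p : EndPair N → Prop}
    (gen : ∀ A ∈ S, p A) (zero : p 0) (add : ∀ A B, p A → p B → p (A + B))
    (smul : ∀ (c : ℂ) A, p A → p (c • A)) (closed : IsClosed {A | p A}) {A : EndPair N}
    (hA : A ∈ (Submodule.span ℂ S).topologicalClosure) : p A := by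
  have h : (Submodule.span ℂ S : Set (EndPair N)) ⊆ {A | p A} := fun B hB =>
    Submodule.span_induction (p := fun B _ => p B) gen zero (fun A B _ _ => add A B)
      (fun c A _ => smul c A) hB
  exact closure_minimal h closed hA

end EndPair

open EndPair

/-! ### The algebras `L(M)` and `R(M)` -/

/-- `ℓ(x, y) = ([x y ·], [y x ·])`. -/
def ellPair (x y : M) : EndPair M := EndPair.mk (opL x y) (opL y x)

/-- `r(x, y) = ([· x y], [· y x])`. -/
def arrPair (x y : M) : EndPair M := EndPair.mk (opR x y) (opR y x)

variable (M) in
/-- `L(M)`: the closed linear span in `E(M)` of the elements `ℓ(x, y)`. -/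
def LAlg : Submodule ℂ (EndPair M) :=
  (Submodule.span ℂ {A | ∃ x y : M, A = ellPair x y}).topologicalClosure

variable (M) in
/-- `R(M)`: the closed linear span in `E(M)` of the elements `r(x, y)`. -/
def RAlg : Submodule ℂ (EndPair M) :=
  (Submodule.span ℂ {A | ∃ x y : M, A = arrPair x y}).topologicalClosure

theorem ellPair_mem (x y : M) : ellPair x y ∈ LAlg M :=
  Submodule.le_topologicalClosure _ (Submodule.subset_span ⟨x, y, rfl⟩)

theorem arrPair_mem (x y : M) : arrPair x y ∈ RAlg M :=
  Submodule.le_topologicalClosure _ (Submodule.subset_span ⟨x, y, rfl⟩)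

theorem isClosed_LAlg : IsClosed (LAlg M : Set (EndPair M)) :=
  Submodule.isClosed_topologicalClosure _

theorem isClosed_RAlg : IsClosed (RAlg M : Set (EndPair M)) :=
  Submodule.isClosed_topologicalClosure _

theorem norm_arrPair_le (x y : M) : ‖arrPair x y‖ ≤ ‖x‖ * ‖y‖ :=
  max_le (norm_opR_le x y) ((norm_opR_le y x).trans_eq (mul_comm _ _))

theorem inv_mem_L {A : EndPair M} (hA : A ∈ LAlg M) : inv A ∈ LAlg M := by
  refine closure_span_induction (p := fun A => inv A ∈ LAlg M) ?_ ?_ ?_ ?_ ?_ hA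
  · rintro _ ⟨x, y, rfl⟩; exact ellPair_mem y x
  · exact (LAlg M).zero_mem
  · intro A B hA hB; exact (LAlg M).add_mem hA hB
  · intro c A hA
    exact (LAlg M).smul_mem (starRingEnd ℂ c) hA |> fun h => by
      convert h using 1
      exact EndPair.ext (fun _ => rfl) (fun _ => by simp)
  · exact isClosed_LAlg.preimage EndPair.continuous_inv

theorem inv_mem_R {A : EndPair M} (hA : A ∈ RAlg M) : inv A ∈ RAlg M := by
  refine closure_span_induction (p := fun A => inv A ∈ RAlg M) ?_ ?_ ?_ ?_ ?_ hA
  · rintro _ ⟨x, y, rfl⟩; exact arrPair_mem y x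
  · exact (RAlg M).zero_mem
  · intro A B hA hB; exact (RAlg M).add_mem hA hB
  · intro c A hA
    exact (RAlg M).smul_mem (starRingEnd ℂ c) hA |> fun h => by
      convert h using 1
      exact EndPair.ext (fun _ => rfl) (fun _ => by simp)
  · exact isClosed_RAlg.preimage EndPair.continuous_inv

theorem L_one_triple {A : EndPair M} (hA : A ∈ LAlg M) (x y z : M) :
    A.one (triple x y z) = triple (A.one x) y z := by
  refine closure_span_induction (p := fun A => A.one (triple x y z) = triple (A.one x) y z)
    ?_ ?_ ?_ ?_ ?_ hA
  · rintro _ ⟨a, b, rfl⟩; exact (triple_assoc a b x y z).symm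
  · exact ((opR y z).map_zero).symm
  · intro A B hA hB; simp [hA, hB, triple_add_left]
  · intro c A hA; simp [hA, triple_smul_left]
  · exact isClosed_eq (continuous_one_apply _)
      ((opR y z).continuous.comp (continuous_one_apply x))

theorem L_mid {A : EndPair M} (hA : A ∈ LAlg M) (x y z : M) :
    triple x (A.two y) z = triple x y (A.one z) := by
  refine closure_span_induction (p := fun A => triple x (A.two y) z = triple x y (A.one z))
    ?_ ?_ ?_ ?_ ?_ hA
  · rintro _ ⟨a, b, rfl⟩
    exact (triple_assoc_mid x y a b z).symm.trans (triple_assoc x y a b z)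
  · exact ((opM x z).map_zero).trans ((opL x y).map_zero).symm
  · intro A B hA hB; simp [hA, hB, triple_add_mid, triple_add_right]
  · intro c A hA; simp [hA, triple_smul_mid, triple_smul_right]
  · exact isClosed_eq ((opM x z).continuous.comp (continuous_two_apply y))
      ((opL x y).continuous.comp (continuous_one_apply z))

theorem R_one_triple {A : EndPair M} (hA : A ∈ RAlg M) (x y z : M) :
    A.one (triple x y z) = triple x y (A.one z) := by
  refine closure_span_induction (p := fun A => A.one (triple x y z) = triple x y (A.one z))
    ?_ ?_ ?_ ?_ ?_ hA
  · rintro _ ⟨a, b, rfl⟩; exact triple_assoc x y z a b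
  · exact ((opL x y).map_zero).symm
  · intro A B hA hB; simp [hA, hB, triple_add_right]
  · intro c A hA; simp [hA, triple_smul_right]
  · exact isClosed_eq (continuous_one_apply _)
      ((opL x y).continuous.comp (continuous_one_apply z))

theorem R_mid {A : EndPair M} (hA : A ∈ RAlg M) (x y z : M) :
    triple x (A.two y) z = triple (A.one x) y z := by
  refine closure_span_induction (p := fun A => triple x (A.two y) z = triple (A.one x) y z)
    ?_ ?_ ?_ ?_ ?_ hA
  · rintro _ ⟨a, b, rfl⟩
    exact (triple_assoc_mid x a b y z).symm
  · exact ((opM x z).map_zero).trans ((opR y z).map_zero).symm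
  · intro A B hA hB; simp [hA, hB, triple_add_mid, triple_add_left]
  · intro c A hA; simp [hA, triple_smul_mid, triple_smul_left]
  · exact isClosed_eq ((opM x z).continuous.comp (continuous_two_apply y))
      ((opR y z).continuous.comp (continuous_one_apply x))

theorem L_two_triple {A : EndPair M} (hA : A ∈ LAlg M) (x y z : M) :
    A.two (triple x y z) = triple (A.two x) y z := L_one_triple (inv_mem_L hA) x y z

theorem L_mid' {A : EndPair M} (hA : A ∈ LAlg M) (x y z : M) :
    triple x (A.one y) z = triple x y (A.two z) := L_mid (inv_mem_L hA) x y z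

theorem R_two_triple {A : EndPair M} (hA : A ∈ RAlg M) (x y z : M) :
    A.two (triple x y z) = triple x y (A.two z) := R_one_triple (inv_mem_R hA) x y z

theorem R_mid' {A : EndPair M} (hA : A ∈ RAlg M) (x y z : M) :
    triple x (A.one y) z = triple (A.two x) y z := R_mid (inv_mem_R hA) x y z

theorem mul_ellPair {A : EndPair M} (hA : A ∈ LAlg M) (x y : M) :
    mul A (ellPair x y) = ellPair (A.one x) y :=
  EndPair.ext (L_one_triple hA x y) (fun z => (L_mid' hA y x z).symm)

theorem arrPair_mul {A : EndPair M} (hA : A ∈ RAlg M) (x y : M) :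
    mul (arrPair x y) A = arrPair (A.two x) y :=
  EndPair.ext (fun z => (R_mid hA z x y).symm) (fun z => R_two_triple hA z y x)

theorem mul_arrPair {A : EndPair M} (hA : A ∈ RAlg M) (x y : M) :
    mul A (arrPair x y) = arrPair x (A.one y) :=
  EndPair.ext (fun z => R_one_triple hA z x y) (fun z => (R_mid' hA z y x).symm)

theorem arrPair_one {A : EndPair M} (hA : A ∈ LAlg M) (x y : M) :
    arrPair x (A.one y) = arrPair (A.two x) y :=
  EndPair.ext (fun z => (L_mid hA z x y).symm) (fun z => L_mid' hA z y x)

theorem mul_mem_L {A B : EndPair M} (hA : A ∈ LAlg M) (hB : B ∈ LAlg M) :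
    mul A B ∈ LAlg M := by
  refine closure_span_induction (p := fun B => mul A B ∈ LAlg M) ?_ ?_ ?_ ?_ ?_ hB
  · rintro _ ⟨x, y, rfl⟩
    rw [mul_ellPair hA]
    exact ellPair_mem _ _
  · have : mul A 0 = 0 := EndPair.ext (fun _ => by simp) (fun _ => by simp)
    rw [this]; exact (LAlg M).zero_mem
  · intro B C hB hC
    have : mul A (B + C) = mul A B + mul A C :=
      EndPair.ext (fun _ => by simp) (fun _ => by simp)
    rw [this]; exact (LAlg M).add_mem hB hC
  · intro c B hB
    have : mul A (c • B) = c • mul A B := EndPair.ext (fun _ => by simp) (fun _ => by simp)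
    rw [this]; exact (LAlg M).smul_mem c hB
  · exact isClosed_LAlg.preimage (continuous_mul_left A)

theorem mul_mem_R {A B : EndPair M} (hA : A ∈ RAlg M) (hB : B ∈ RAlg M) :
    mul A B ∈ RAlg M := by
  refine closure_span_induction (p := fun B => mul A B ∈ RAlg M) ?_ ?_ ?_ ?_ ?_ hB
  · rintro _ ⟨x, y, rfl⟩
    rw [mul_arrPair hA]
    exact arrPair_mem _ _
  · have : mul A 0 = 0 := EndPair.ext (fun _ => by simp) (fun _ => by simp)
    rw [this]; exact (RAlg M).zero_mem
  · intro B C hB hC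
    have : mul A (B + C) = mul A B + mul A C :=
      EndPair.ext (fun _ => by simp) (fun _ => by simp)
    rw [this]; exact (RAlg M).add_mem hB hC
  · intro c B hB
    have : mul A (c • B) = c • mul A B := EndPair.ext (fun _ => by simp) (fun _ => by simp)
    rw [this]; exact (RAlg M).smul_mem c hB
  · exact isClosed_RAlg.preimage (continuous_mul_left A)

theorem L_comm_R {A B : EndPair M} (hA : A ∈ LAlg M) (hB : B ∈ RAlg M) (x : M) :
    A.one (B.one x) = B.one (A.one x) := by
  refine closure_span_induction (p := fun B => A.one (B.one x) = B.one (A.one x))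
    ?_ ?_ ?_ ?_ ?_ hB
  · rintro _ ⟨u, v, rfl⟩; exact L_one_triple hA x u v
  · simp
  · intro B C hB hC; simp [hB, hC]
  · intro c B hB; simp [hB]
  · exact isClosed_eq (A.one.continuous.comp (continuous_one_apply x)) (continuous_one_apply _)

theorem L_comm_R' {A B : EndPair M} (hA : A ∈ LAlg M) (hB : B ∈ RAlg M) (x : M) :
    A.two (B.two x) = B.two (A.two x) := L_comm_R (inv_mem_L hA) (inv_mem_R hB) x

/-- `ℓ(x, y)` as an element of `L(M)`. -/
def ell (x y : M) : LAlg M := ⟨ellPair x y, ellPair_mem x y⟩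

/-- `r(x, y)` as an element of `R(M)`. -/
def arr (x y : M) : RAlg M := ⟨arrPair x y, arrPair_mem x y⟩

@[simp] theorem coe_ell (x y : M) : (ell x y : EndPair M) = ellPair x y := rfl
@[simp] theorem coe_arr (x y : M) : (arr x y : EndPair M) = arrPair x y := rfl
@[simp] theorem ellPair_one (x y z : M) : (ellPair x y).one z = triple x y z := rfl
@[simp] theorem ellPair_two (x y z : M) : (ellPair x y).two z = triple y x z := rfl
@[simp] theorem arrPair_one_apply (x y z : M) : (arrPair x y).one z = triple z x y := rfl
@[simp] theorem arrPair_two_apply (x y z : M) : (arrPair x y).two z = triple z y x := rfl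

/-- The product `AA'` of `L(M)`, inherited from `E(M)`. -/
def Lmul (A A' : LAlg M) : LAlg M := ⟨EndPair.mul A.1 A'.1, mul_mem_L A.2 A'.2⟩

/-- The product `B ∘ B'` of `R(M)`, inherited from the opposite algebra of `E(M)`. -/
def Rmul (B B' : RAlg M) : RAlg M := ⟨EndPair.mul B'.1 B.1, mul_mem_R B'.2 B.2⟩

/-- The involution of `L(M)`. -/
def Linv (A : LAlg M) : LAlg M := ⟨EndPair.inv A.1, inv_mem_L A.2⟩

/-- The involution of `R(M)`. -/
def Rinv (B : RAlg M) : RAlg M := ⟨EndPair.inv B.1, inv_mem_R B.2⟩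

/-! ### The standard embedding as a *-algebra -/

variable (M) in
/-- The standard embedding `𝒜(M)`: the space of matrices `(A, f; ḡ, B)` with `A ∈ L(M)`,
`f ∈ M`, `ḡ` in the conjugate space of `M` and `B ∈ R(M)`. -/
@[ext]
structure StdEmb where
  ul : LAlg M
  ur : M
  ll : ConjSpace M
  lr : RAlg M

namespace StdEmb

/-- The vector space underlying the standard embedding. -/
def toProd (a : StdEmb M) : LAlg M × M × ConjSpace M × RAlg M := (a.ul, a.ur, a.ll, a.lr)

/-- `toProd` as a bijection. -/
def equivProd : StdEmb M ≃ LAlg M × M × ConjSpace M × RAlg M where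
  toFun := toProd
  invFun p := ⟨p.1, p.2.1, p.2.2.1, p.2.2.2⟩
  left_inv _ := rfl
  right_inv _ := rfl

/- The componentwise vector space structure. -/
instance : AddCommGroup (StdEmb M) := equivProd.addCommGroup
instance : Module ℂ (StdEmb M) := equivProd.module ℂ

section
variable (a b : StdEmb M) (c : ℂ)
@[simp] theorem ul_zero : (0 : StdEmb M).ul = 0 := rfl
@[simp] theorem ur_zero : (0 : StdEmb M).ur = 0 := rfl
@[simp] theorem ll_zero : (0 : StdEmb M).ll = 0 := rfl
@[simp] theorem lr_zero : (0 : StdEmb M).lr = 0 := rfl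
@[simp] theorem ul_add : (a + b).ul = a.ul + b.ul := rfl
@[simp] theorem ur_add : (a + b).ur = a.ur + b.ur := rfl
@[simp] theorem ll_add : (a + b).ll = a.ll + b.ll := rfl
@[simp] theorem lr_add : (a + b).lr = a.lr + b.lr := rfl
@[simp] theorem ul_smul : (c • a).ul = c • a.ul := rfl
@[simp] theorem ur_smul : (c • a).ur = c • a.ur := rfl
@[simp] theorem ll_smul : (c • a).ll = c • a.ll := rfl
@[simp] theorem lr_smul : (c • a).lr = c • a.lr := rfl
end

/-- The product
`(A, f; ḡ, B) (A', f'; ḡ', B') =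
  (AA' + ℓ(f, g'), A·f' + f·B'; ḡ·A' + B·ḡ', r(g, f') + B ∘ B')`, where
`A·f = A₁ f`, `f·B = B₁ f`, and where `ḡ·A`, `B·ḡ` are the conjugates of `A₂ g`, `B₂ g`. -/
instance : Mul (StdEmb M) :=
  ⟨fun a b =>
    ⟨Lmul a.ul b.ul + ell a.ur (conj.symm b.ll),
      a.ul.1.one b.ur + b.lr.1.one a.ur,
      conj (b.ul.1.two (conj.symm a.ll) + a.lr.1.two (conj.symm b.ll)),
      arr (conj.symm a.ll) b.ur + Rmul a.lr b.lr⟩⟩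

/-- The involution `(A, f; ḡ, B) ↦ (Ā, g; f̄, B̄)`. -/
instance : Star (StdEmb M) :=
  ⟨fun a => ⟨Linv a.ul, conj.symm a.ll, conj a.ur, Rinv a.lr⟩⟩

/-! ### The representation on `M ⊕ R(M)` and the norm -/

variable (M) in
/-- The Banach space `M ⊕ R(M)` with the norm `(‖f‖ ^ 2 + ‖B‖ ^ 2) ^ (1/2)`. -/
abbrev RepSpace : Type _ := WithLp 2 (M × RAlg M)

/-- `C ↦ f·C`, from `R(M)` to `M`. -/
def actR (f : M) : RAlg M →L[ℂ] M :=
  LinearMap.mkContinuous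
    { toFun := fun C : RAlg M => C.1.one f
      map_add' := fun _ _ => rfl
      map_smul' := fun _ _ => rfl }
    ‖f‖ (fun C : RAlg M => by
      refine (C.1.one.le_opNorm f).trans ?_
      rw [mul_comm]
      exact mul_le_mul_of_nonneg_left C.1.norm_one_le (norm_nonneg _))

/-- `x ↦ r(g, x)`, from `M` to `R(M)`. -/
def arrCLM (g : M) : M →L[ℂ] RAlg M :=
  LinearMap.mkContinuous
    { toFun := fun x => arr g x
      map_add' := fun x y => Subtype.ext <| EndPair.ext
        (fun z => by simp [triple_add_right]) (fun z => by simp [triple_add_mid])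
      map_smul' := fun c x => Subtype.ext <| EndPair.ext
        (fun z => by simp [triple_smul_right]) (fun z => by simp [triple_smul_mid]) }
    ‖g‖ (fun x => norm_arrPair_le g x)

/-- `C ↦ B ∘ C`, from `R(M)` to `R(M)`. -/
def RmulCLM (B : RAlg M) : RAlg M →L[ℂ] RAlg M :=
  LinearMap.mkContinuous
    { toFun := fun C => Rmul B C
      map_add' := fun C D => Subtype.ext <| EndPair.ext
        (fun z => rfl) (fun z => by simp [Rmul])
      map_smul' := fun c C => Subtype.ext <| EndPair.ext
        (fun z => rfl) (fun z => by simp [Rmul]) }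
    ‖B‖ (fun C => (EndPair.norm_mul_le C.1 B.1).trans_eq (mul_comm _ _))

/-- The operator `π(a) : (f', B') ↦ (A·f' + f·B', r(g, f') + B ∘ B')` on `M ⊕ R(M)`, for
`a = (A, f; ḡ, B)`. -/
def rep (a : StdEmb M) : RepSpace M →L[ℂ] RepSpace M :=
  (WithLp.prodContinuousLinearEquiv 2 ℂ M (RAlg M)).symm.toContinuousLinearMap ∘L
    ((a.ul.1.one.coprod (actR a.ur)).prod
      ((arrCLM (conj.symm a.ll)).coprod (RmulCLM a.lr))) ∘L
    (WithLp.prodContinuousLinearEquiv 2 ℂ M (RAlg M)).toContinuousLinearMap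

theorem rep_apply (a : StdEmb M) (f : M) (B : RAlg M) :
    rep a (WithLp.toLp 2 (f, B)) =
      WithLp.toLp 2 (a.ul.1.one f + B.1.one a.ur, arr (conj.symm a.ll) f + Rmul a.lr B) := rfl

theorem rep_ext {T S : RepSpace M →L[ℂ] RepSpace M}
    (h : ∀ f B, T (WithLp.toLp 2 (f, B)) = S (WithLp.toLp 2 (f, B))) : T = S :=
  ContinuousLinearMap.ext fun v => h v.fst v.snd

theorem toLp_congr {f f' : M} {B B' : RAlg M} (h₁ : f = f')
    (h₂ : ∀ x, B.1.one x = B'.1.one x) (h₃ : ∀ x, B.1.two x = B'.1.two x) :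
    WithLp.toLp 2 (f, B) = WithLp.toLp 2 (f', B') := by
  have : B = B' := Subtype.ext (EndPair.ext h₂ h₃)
  rw [h₁, this]

theorem rep_add (a b : StdEmb M) : rep (a + b) = rep a + rep b := by
  refine rep_ext fun f B => ?_
  rw [_root_.add_apply, rep_apply, rep_apply, rep_apply, ← WithLp.toLp_add]
  refine toLp_congr ?_ (fun x => ?_) (fun x => ?_)
  · simp; abel
  · simp [Rmul, triple_add_mid]; abel
  · simp [Rmul, triple_add_right]; abel

theorem rep_smul (c : ℂ) (a : StdEmb M) : rep (c • a) = c • rep a := by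
  refine rep_ext fun f B => ?_
  rw [_root_.smul_apply, rep_apply, rep_apply, ← WithLp.toLp_smul]
  refine toLp_congr ?_ (fun x => ?_) (fun x => ?_)
  · simp
  · simp [Rmul, triple_smul_mid, conj_symm_smul]
  · simp [Rmul, triple_smul_right, conj_symm_smul]

variable (M) in
/-- The linear map `π : 𝒜(M) → B(M ⊕ R(M))`. -/
def repHom : StdEmb M →ₗ[ℂ] (RepSpace M →L[ℂ] RepSpace M) where
  toFun := rep
  map_add' := rep_add
  map_smul' := rep_smul

theorem rep_mul (a b : StdEmb M) : rep (a * b) = rep a ∘L rep b := by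
  refine rep_ext fun f C => ?_
  rw [ContinuousLinearMap.comp_apply, rep_apply, rep_apply, rep_apply]
  have hA := a.ul.2
  have hB := a.lr.2
  have hA' := b.ul.2
  have hB' := b.lr.2
  have hC := C.2
  refine toLp_congr ?_ (fun x => ?_) (fun x => ?_)
  · change (Lmul a.ul b.ul + ell a.ur (conj.symm b.ll)).1.one f +
      C.1.one (a.ul.1.one b.ur + b.lr.1.one a.ur) = _
    simp [Lmul, Rmul, L_comm_R hA hC]
    abel
  · change (arr (conj.symm (conj (b.ul.1.two (conj.symm a.ll) +
      a.lr.1.two (conj.symm b.ll)))) f +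
      Rmul (arr (conj.symm a.ll) b.ur + Rmul a.lr b.lr) C).1.one x = _
    simp [Rmul, triple_add_mid, triple_add_right, R_one_triple hC, L_mid hA', R_mid hB]
    abel
  · change (arr (conj.symm (conj (b.ul.1.two (conj.symm a.ll) +
      a.lr.1.two (conj.symm b.ll)))) f +
      Rmul (arr (conj.symm a.ll) b.ur + Rmul a.lr b.lr) C).1.two x = _
    simp [Rmul, triple_add_mid, triple_add_right, R_two_triple hB, L_mid' hA', R_mid' hC]
    abel

theorem rep_injective : Function.Injective (repHom M) := by
  refine (injective_iff_map_eq_zero _).2 fun a ha => ?_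
  have key : ∀ f B, a.ul.1.one f + B.1.one a.ur = 0 ∧
      arr (conj.symm a.ll) f + Rmul a.lr B = 0 := by
    intro f B
    have h : rep a (WithLp.toLp 2 (f, B)) = 0 := by
      change repHom M a _ = 0
      rw [ha]; rfl
    rw [rep_apply] at h
    exact Prod.ext_iff.1 (congrArg WithLp.ofLp h)
  have h1 : ∀ f, a.ul.1.one f = 0 := fun f => by simpa using (key f 0).1
  have h2 : ∀ B : RAlg M, B.1.one a.ur = 0 := fun B => by simpa using (key 0 B).1
  have h3 : ∀ f x, triple x (conj.symm a.ll) f = 0 := fun f x => by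
    have h := congrArg (fun B : RAlg M => B.1.one x) (key f 0).2
    simpa [Rmul] using h
  have h4 : ∀ B : RAlg M, Rmul a.lr B = 0 := fun B => by
    have h : arr (conj.symm a.ll) (0 : M) = 0 := (arrCLM (conj.symm a.ll)).map_zero
    simpa [h] using (key 0 B).2
  have e1 : ∀ f, a.ul.1.two f = 0 := fun f => eq_zero_of_triple_self <| by
    rw [L_mid a.ul.2, h1]
    exact (opL _ _).map_zero
  have e2 : a.ur = 0 := eq_zero_of_triple_self (h2 (arr a.ur a.ur))
  have e3 : conj.symm a.ll = 0 := eq_zero_of_triple_self (h3 _ _)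
  have e4 : ∀ f, a.lr.1.one f = 0 := fun f => eq_zero_of_triple_self <| by
    have h := congrArg (fun B : RAlg M => B.1.one f)
      (h4 (arr (a.lr.1.one f) (a.lr.1.one f)))
    simpa [Rmul] using h
  have e5 : ∀ f, a.lr.1.two f = 0 := fun f => eq_zero_of_triple_self <| by
    have h := congrArg (fun B : RAlg M => B.1.two (a.lr.1.two f))
      (h4 (arr f (a.lr.1.two f)))
    simpa [Rmul, R_two_triple a.lr.2] using h
  refine StdEmb.ext ?_ e2 ?_ ?_
  · exact Subtype.ext (EndPair.ext h1 e1)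
  · exact (conj (V := M)).symm.map_eq_zero_iff.1 e3
  · exact Subtype.ext (EndPair.ext e4 e5)

/-- The operator norm `‖a‖ = ‖π(a)‖` on the standard embedding. -/
instance : NormedAddCommGroup (StdEmb M) :=
  NormedAddCommGroup.induced (StdEmb M) (RepSpace M →L[ℂ] RepSpace M) (repHom M) rep_injective

instance : NormedSpace ℂ (StdEmb M) :=
  NormedSpace.induced ℂ (StdEmb M) (RepSpace M →L[ℂ] RepSpace M) (repHom M)

theorem norm_def (a : StdEmb M) : ‖a‖ = ‖rep a‖ := rfl

/-- The (normed) algebra structure of the standard embedding. -/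
instance : NonUnitalNormedRing (StdEmb M) where
  left_distrib a b c := rep_injective <| by
    change rep _ = rep _
    rw [rep_add, rep_mul, rep_mul, rep_mul, rep_add, ContinuousLinearMap.comp_add]
  right_distrib a b c := rep_injective <| by
    change rep _ = rep _
    rw [rep_add, rep_mul, rep_mul, rep_mul, rep_add, ContinuousLinearMap.add_comp]
  zero_mul a := rep_injective <| by
    change rep _ = rep _
    rw [rep_mul, show rep (0 : StdEmb M) = 0 from (repHom M).map_zero,
      ContinuousLinearMap.zero_comp]
  mul_zero a := rep_injective <| by
    change rep _ = rep _
    rw [rep_mul, show rep (0 : StdEmb M) = 0 from (repHom M).map_zero,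
      ContinuousLinearMap.comp_zero]
  mul_assoc a b c := rep_injective <| by
    change rep _ = rep _
    simp only [rep_mul, ContinuousLinearMap.comp_assoc]
  dist_eq := NormedAddCommGroup.dist_eq
  norm_mul_le a b := by
    rw [norm_def, rep_mul]
    exact ContinuousLinearMap.opNorm_comp_le _ _

instance : IsScalarTower ℂ (StdEmb M) (StdEmb M) where
  smul_assoc c a b := rep_injective <| by
    change rep _ = rep _
    simp only [smul_eq_mul, rep_mul, rep_smul, ContinuousLinearMap.smul_comp]

instance : SMulCommClass ℂ (StdEmb M) (StdEmb M) where
  smul_comm c a b := rep_injective <| by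
    change rep _ = rep _
    simp only [smul_eq_mul, rep_mul, rep_smul, ContinuousLinearMap.comp_smul]

instance : StarRing (StdEmb M) where
  star_involutive _ := rfl
  star_add _ _ := rfl
  star_mul a b := by
    refine StdEmb.ext ?_ ?_ ?_ ?_
    · exact Subtype.ext (EndPair.ext (fun _ => rfl) (fun _ => rfl))
    · rfl
    · change conj _ = conj _
      congr 1
    · exact Subtype.ext (EndPair.ext (fun _ => rfl) (fun _ => rfl))

instance : StarModule ℂ (StdEmb M) where
  star_smul c a := by
    refine StdEmb.ext ?_ ?_ ?_ ?_
    · exact Subtype.ext (EndPair.ext (fun _ => rfl)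
        (fun x => by
          change c • a.ul.1.one x = starRingEnd ℂ (starRingEnd ℂ c) • a.ul.1.one x
          rw [Complex.conj_conj]))
    · rfl
    · exact conj_smul c a.ur
    · exact Subtype.ext (EndPair.ext (fun _ => rfl)
        (fun x => by
          change c • a.lr.1.one x = starRingEnd ℂ (starRingEnd ℂ c) • a.lr.1.one x
          rw [Complex.conj_conj]))

end StdEmb

/-! ### Closed ideals -/

variable (M) in
/-- A closed ideal of `M`: a closed linear subspace `I` with `[MMI] ⊆ I`, `[IMM] ⊆ I` and
`[MIM] ⊆ I`. -/
structure ClosedTernaryIdeal extends Submodule ℂ M where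
  triple_right_mem : ∀ x y : M, ∀ z ∈ carrier, triple x y z ∈ carrier
  triple_left_mem : ∀ x ∈ carrier, ∀ y z : M, triple x y z ∈ carrier
  triple_mid_mem : ∀ x : M, ∀ y ∈ carrier, ∀ z : M, triple x y z ∈ carrier
  isClosed : IsClosed carrier

/-- A closed ideal is itself a C*-ternary ring, with the restricted triple product and norm. -/
instance (I : ClosedTernaryIdeal M) : CStarTernaryRing I.toSubmodule where
  toCompleteSpace := by
    have : CompleteSpace M := CStarTernaryRing.toCompleteSpace
    exact I.isClosed.completeSpace_coe
  triple x y z := ⟨triple x.1 y.1 z.1, I.triple_right_mem _ _ _ z.2⟩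
  triple_add_left _ _ _ _ := Subtype.ext (triple_add_left _ _ _ _)
  triple_smul_left _ _ _ _ := Subtype.ext (triple_smul_left _ _ _ _)
  triple_add_mid _ _ _ _ := Subtype.ext (triple_add_mid _ _ _ _)
  triple_smul_mid _ _ _ _ := Subtype.ext (triple_smul_mid _ _ _ _)
  triple_add_right _ _ _ _ := Subtype.ext (triple_add_right _ _ _ _)
  triple_smul_right _ _ _ _ := Subtype.ext (triple_smul_right _ _ _ _)
  triple_assoc_mid _ _ _ _ _ := Subtype.ext (triple_assoc_mid _ _ _ _ _)
  triple_assoc _ _ _ _ _ := Subtype.ext (triple_assoc _ _ _ _ _)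
  norm_triple_le _ _ _ := norm_triple_le (M := M) _ _ _
  norm_triple_self _ := norm_triple_self (M := M) _

end CStarTernary

end

/-!
The argument rests on two facts about a C*-ternary ring `M` and a closed ideal `I`.

*Extension from `I` to `M` is isometric.* Let `A` be in the closed span `idealL I ⊆ L(M)` of the
`ℓ(x, y)` with `x, y ∈ I`. For `z ∈ M` the element `w = A₁ z` lies in `I`, and so does `[z w w]`;
hence `‖w‖ ^ 3 = ‖[w w w]‖ = ‖A₁ [z w w]‖ ≤ ‖A₁|I‖ ‖z‖ ‖w‖ ^ 2`, so `‖A₁‖ = ‖A₁|I‖`. The same works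
for `A₂` and, mirrored, for the closed span `idealR I ⊆ R(M)`. Therefore extension of operators is
an isometric isomorphism of `L(I)` onto `idealL I`, and likewise of `R(I)` onto `idealR I`
(`exists_linearEquiv_extends`): on generators it is `ℓ(x, y) ↦ ℓ(x, y)`, and it passes to the
closed spans since its graph is closed. Putting these on the diagonal and the inclusions `I ⊆ M` off
the diagonal gives `StdEmb.ofIdeal`. It is a *-homomorphism because an element of `idealL I` or
`idealR I` is determined by its restriction to `I`. The norm of the standard embedding
is equivalent to the sum of the norms of the four entries (`StdEmb.norm_le_add`,
`StdEmb.norm_ul_le` and its companions), so the map is a homeomorphism onto its image, which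
consists of the matrices with entries in `idealL I`, `I`, `I` and `idealR I` and is closed.

*Elements can be factored approximately.* That the image is an ideal comes down to
`ℓ(x, y) ∈ idealL I` and `r(x, y) ∈ idealR I` for `x ∈ M` and `y ∈ I`. If `y` had the form `[y y v]`
with `v ∈ I`, this would follow from the associativity of the triple product. In fact `y` is a limit
of such elements (`mem_closure_triple_self`, applied to the C*-ternary ring `I`). The pairs of
mutually adjoint operators on `I` form a C*-algebra containing `T = ℓ(y, y)`, and by the continuous
functional calculus `v = T (T ^ 2 + δ ^ 2)⁻¹ y` satisfies `‖y - [y y v]‖ ^ 2 ≤ δ`.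
-/

noncomputable section

namespace CStarTernary

open CStarTernaryRing

/-! ### The normed *-algebra of pairs of operators -/

section EndPairAlgebra

variable {N : Type*} [NormedAddCommGroup N] [NormedSpace ℂ N]

instance : NormedRing (EndPair N) where
  __ := (inferInstance : NormedAddCommGroup (EndPair N))
  mul := EndPair.mul
  one := EndPair.mk (.id ℂ N) (.id ℂ N)
  left_distrib A B C := EndPair.ext (fun x => A.one.map_add _ _) (fun _ => rfl)
  right_distrib A B C := EndPair.ext (fun _ => rfl) (fun x => C.two.map_add _ _)
  zero_mul A := EndPair.ext (fun _ => rfl) (fun x => A.two.map_zero)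
  mul_zero A := EndPair.ext (fun x => A.one.map_zero) (fun _ => rfl)
  mul_assoc _ _ _ := rfl
  one_mul _ := rfl
  mul_one _ := rfl
  dist_eq := NormedAddCommGroup.dist_eq
  norm_mul_le := EndPair.norm_mul_le

instance : Algebra ℂ (EndPair N) :=
  Algebra.ofModule
    (fun _ _ B => EndPair.ext (fun _ => rfl) (fun _ => B.two.map_smul _ _))
    (fun _ A _ => EndPair.ext (fun _ => A.one.map_smul _ _) (fun _ => rfl))

instance : NormedAlgebra ℂ (EndPair N) where
  norm_smul_le := norm_smul_le

instance : StarRing (EndPair N) where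
  star := EndPair.inv
  star_involutive _ := rfl
  star_mul _ _ := rfl
  star_add _ _ := rfl

instance : StarModule ℂ (EndPair N) where
  star_smul c A := EndPair.ext (fun _ => rfl)
    (fun x => by
      change c • A.one x = starRingEnd ℂ (starRingEnd ℂ c) • A.one x
      rw [Complex.conj_conj])

instance [CompleteSpace N] : CompleteSpace (EndPair N) :=
  inferInstanceAs (CompleteSpace ((N →L[ℂ] N) × (N →L[ℂ] N)))

end EndPairAlgebra

/-! ### Adjointable operators -/

theorem sq_opNorm_le_bound {N : Type*} [NormedAddCommGroup N] [NormedSpace ℂ N] {T : N →L[ℂ] N}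
    {c : ℝ} (hc : 0 ≤ c) (h : ∀ z, ‖T z‖ ^ 2 ≤ c * ‖z‖ ^ 2) : ‖T‖ ^ 2 ≤ c := by
  refine (Real.le_sqrt (norm_nonneg _) hc).1 (T.opNorm_le_bound (Real.sqrt_nonneg _) fun z => ?_)
  refine (sq_le_sq₀ (norm_nonneg _) (by positivity)).1 ?_
  rw [mul_pow, Real.sq_sqrt hc]
  exact h z

variable {M : Type*} [NormedAddCommGroup M] [NormedSpace ℂ M] [CStarTernaryRing M]

variable (M) in
/-- The *-algebra of pairs of mutually adjoint operators: the `(A₁, A₂) ∈ E(M)` such that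
`[x, A₂ y, z] = [x, y, A₁ z]` and `[x, A₁ y, z] = [x, y, A₂ z]`. -/
def adjointable : StarSubalgebra ℂ (EndPair M) where
  carrier := {A | ∀ x y z, triple x (A.two y) z = triple x y (A.one z) ∧
    triple x (A.one y) z = triple x y (A.two z)}
  mul_mem' {A B} hA hB x y z :=
    ⟨by change triple x (B.two (A.two y)) z = triple x y (A.one (B.one z))
        rw [(hB _ _ _).1, (hA _ _ _).1],
      by change triple x (A.one (B.one y)) z = triple x y (B.two (A.two z))
         rw [(hA _ _ _).2, (hB _ _ _).2]⟩
  add_mem' {A B} hA hB x y z :=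
    ⟨by simp [triple_add_mid, triple_add_right, (hA _ _ _).1, (hB _ _ _).1],
      by simp [triple_add_mid, triple_add_right, (hA _ _ _).2, (hB _ _ _).2]⟩
  algebraMap_mem' c x y z := by
    change triple x (starRingEnd ℂ c • y) z = triple x y (c • z) ∧
      triple x (c • y) z = triple x y (starRingEnd ℂ c • z)
    simp [triple_smul_mid, triple_smul_right]
  star_mem' {A} hA x y z := ⟨(hA x y z).2, (hA x y z).1⟩

theorem mem_adjointable_of_mem_LAlg {A : EndPair M} (hA : A ∈ LAlg M) : A ∈ adjointable M :=
  fun x y z => ⟨L_mid hA x y z, L_mid' hA x y z⟩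

theorem isClosed_adjointable : IsClosed (adjointable M : Set (EndPair M)) := by
  have : (adjointable M : Set (EndPair M)) = ⋂ (x : M) (y : M) (z : M),
      {A | opM x z (A.two y) = opL x y (A.one z)} ∩
        {A | opM x z (A.one y) = opL x y (A.two z)} := by
    ext A
    simp only [Set.mem_iInter]
    rfl
  rw [this]
  refine isClosed_iInter fun x => isClosed_iInter fun y => isClosed_iInter fun z => .inter ?_ ?_
  · exact isClosed_eq (by fun_prop) (by fun_prop)
  · exact isClosed_eq (by fun_prop) (by fun_prop)

/-- Through `‖[w w w]‖ = ‖w‖ ^ 3`, an estimate for `[w w w]` becomes one for `w`. -/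
theorem norm_le_of_norm_triple_self_le {w : M} {c : ℝ} (hc : 0 ≤ c)
    (h : ‖triple w w w‖ ≤ c * ‖w‖ ^ 2) : ‖w‖ ≤ c := by
  rcases (norm_nonneg w).eq_or_lt with h0 | h0
  · rwa [← h0]
  · rw [norm_triple_self] at h
    have : ‖w‖ * ‖w‖ ^ 2 ≤ c * ‖w‖ ^ 2 := by linarith
    exact le_of_mul_le_mul_right this (by positivity)

theorem sq_norm_le_of_norm_triple_self_le {w : M} {c : ℝ} (hc : 0 ≤ c)
    (h : ‖triple w w w‖ ≤ c * ‖w‖) : ‖w‖ ^ 2 ≤ c := by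
  rcases (norm_nonneg w).eq_or_lt with h0 | h0
  · simpa [← h0] using hc
  · rw [norm_triple_self] at h
    have : ‖w‖ ^ 2 * ‖w‖ ≤ c * ‖w‖ := by linarith
    exact le_of_mul_le_mul_right this h0

/-- The triple product is nondegenerate in its last variable. -/
theorem ext_triple {v w : M} (h : ∀ x y, triple x y v = triple x y w) : v = w := by
  refine sub_eq_zero.1 (eq_zero_of_triple_self ?_)
  have h' := h (v - w) (v - w)
  rw [← opL_apply, ← opL_apply] at h'
  rw [← opL_apply, map_sub, h', sub_self]

theorem one_triple_of_mem_adjointable {A : EndPair M} (hA : A ∈ adjointable M) (x y z : M) :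
    A.one (triple x y z) = triple (A.one x) y z :=
  ext_triple fun a b => by
    rw [← (hA _ _ _).1, ← triple_assoc, (hA _ _ _).1, triple_assoc]

theorem norm_two_le_one_of_mem_adjointable {A : EndPair M} (hA : A ∈ adjointable M) :
    ‖A.two‖ ≤ ‖A.one‖ := by
  refine A.two.opNorm_le_bound (norm_nonneg _) fun z => ?_
  refine norm_le_of_norm_triple_self_le (by positivity) ?_
  rw [(hA _ _ _).1]
  calc _ ≤ ‖A.two z‖ * ‖z‖ * (‖A.one‖ * ‖A.two z‖) :=
        (norm_triple_le _ _ _).trans (by gcongr; exact A.one.le_opNorm _)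
    _ = _ := by ring

/-- The C*-identity: `‖A₁ z‖ ^ 3 = ‖[A₁ z, z, A₂ A₁ z]‖`. -/
theorem sq_norm_one_le_of_mem_adjointable {A : EndPair M} (hA : A ∈ adjointable M) :
    ‖A.one‖ ^ 2 ≤ ‖A.two ∘L A.one‖ := by
  refine sq_opNorm_le_bound (norm_nonneg _) fun z => ?_
  refine sq_norm_le_of_norm_triple_self_le (by positivity) ?_
  rw [(hA _ _ _).2]
  calc _ ≤ ‖A.one z‖ * ‖z‖ * (‖A.two ∘L A.one‖ * ‖z‖) :=
        (norm_triple_le _ _ _).trans (by gcongr; exact (A.two ∘L A.one).le_opNorm z)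
    _ = _ := by ring

instance : CStarRing (adjointable M) where
  norm_mul_self_le A := by
    have h2 := norm_two_le_one_of_mem_adjointable A.2
    have h1 := sq_norm_one_le_of_mem_adjointable A.2
    have e : ‖A‖ = ‖A.1.one‖ := max_eq_left h2
    rw [e, ← sq]
    exact h1.trans (EndPair.norm_one_le (star A.1 * A.1))

instance : CompleteSpace (adjointable M) := isClosed_adjointable.completeSpace_coe

instance : CStarAlgebra (adjointable M) where

/-! ### Approximate factorization -/

/-- `ℓ(x, x)` as an element of the C*-algebra of adjointable pairs. -/
def ellSelf (x : M) : adjointable M := ⟨ellPair x x, mem_adjointable_of_mem_LAlg (ellPair_mem x x)⟩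

theorem isSelfAdjoint_ellSelf (x : M) : IsSelfAdjoint (ellSelf x) := rfl

/-- Every element `x` is a limit of elements `[x x v]`. -/
theorem mem_closure_triple_self (x : M) : x ∈ closure (Set.range fun v => triple x x v) := by
  refine Metric.mem_closure_range_iff.2 fun ε hε => ?_
  obtain ⟨δ, hδ, hδε⟩ : ∃ δ : ℝ, 0 < δ ∧ δ < ε ^ 2 := exists_between (by positivity)
  -- With `T = ℓ(x, x)`, `S = T (T² + δ²)⁻¹` and `G = 1 - T S = δ² (T² + δ²)⁻¹`, the error
  -- `x - [x x (S x)]` is `G x`, and `ℓ(G x, G x) = G T G` has norm at most `δ`.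
  set T := ellSelf x
  have hT : IsSelfAdjoint T := isSelfAdjoint_ellSelf x
  have hpos : ∀ t : ℝ, t ^ 2 + δ ^ 2 ≠ 0 := fun t => by positivity
  have hs : Continuous fun t : ℝ => t / (t ^ 2 + δ ^ 2) := by fun_prop (disch := exact hpos _)
  have hg : Continuous fun t : ℝ => δ ^ 2 / (t ^ 2 + δ ^ 2) := by fun_prop (disch := exact hpos _)
  set S := cfc (fun t : ℝ => t / (t ^ 2 + δ ^ 2)) T
  set G := cfc (fun t : ℝ => δ ^ 2 / (t ^ 2 + δ ^ 2)) T
  have hG : IsSelfAdjoint G := cfc_predicate _ T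
  have hGS : G + T * S = 1 := by
    nth_rw 1 [← cfc_id ℝ T]
    rw [← cfc_mul _ _ T, ← cfc_add (R := ℝ) T _ _, ← cfc_one ℝ T]
    refine cfc_congr fun t _ => ?_
    have := hpos t
    simp only [id]
    field_simp
    simp; ring
  have hGTG : ‖G * (T * G)‖ ≤ δ := by
    nth_rw 1 [← cfc_id ℝ T]
    rw [← cfc_mul _ _ T, ← cfc_mul _ _ T]
    refine norm_cfc_le hδ.le fun t _ => ?_
    have h0 : 0 < t ^ 2 + δ ^ 2 := by positivity
    simp only [id, norm_mul, norm_div, Real.norm_eq_abs, abs_of_pos h0, abs_of_pos (pow_pos hδ 2)]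
    rw [← sq_abs t] at h0 ⊢
    rw [show δ ^ 2 / (|t| ^ 2 + δ ^ 2) * (|t| * (δ ^ 2 / (|t| ^ 2 + δ ^ 2))) =
      δ * (|t| * δ ^ 3) / (|t| ^ 2 + δ ^ 2) ^ 2 by field_simp, div_le_iff₀ (by positivity)]
    gcongr
    -- The claim is `|t| δ³ ≤ (t² + δ²)²`, from `2 |t| δ ≤ t² + δ²` and `δ² ≤ t² + δ²`.
    nlinarith [sq_nonneg (|t| - δ), sq_nonneg (|t| ^ 2), sq_nonneg (|t| * δ),
      mul_nonneg (sq_nonneg δ) (sq_nonneg (|t| - δ))]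
  refine ⟨S.1.one x, ?_⟩
  have hy : x - triple x x (S.1.one x) = G.1.one x := by
    have := congrArg (fun A : adjointable M => A.1.one x) hGS
    exact (eq_sub_of_add_eq this).symm
  have hG2 : G.1.two = G.1.one := congrArg (fun A : adjointable M => A.1.one) hG
  rw [dist_eq_norm, hy]
  refine lt_of_pow_lt_pow_left₀ 2 hε.le (lt_of_le_of_lt ?_ hδε)
  refine sq_norm_le_of_norm_triple_self_le hδ.le ?_
  nth_rw 1 [← one_triple_of_mem_adjointable G.2]
  rw [(G.2 _ _ _).2, hG2]
  exact ((G * (T * G)).1.one.le_opNorm _).trans (mul_le_mul_of_nonneg_right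
    ((EndPair.norm_one_le _).trans hGTG) (norm_nonneg _))

/-! ### Norm estimates in the standard embedding -/

theorem norm_one_le_two_of_mem_RAlg {B : EndPair M} (hB : B ∈ RAlg M) : ‖B.one‖ ≤ ‖B.two‖ := by
  refine B.one.opNorm_le_bound (norm_nonneg _) fun z => ?_
  refine norm_le_of_norm_triple_self_le (by positivity) ?_
  rw [R_mid' hB]
  calc _ ≤ ‖B.two‖ * ‖B.one z‖ * ‖z‖ * ‖B.one z‖ :=
        (norm_triple_le _ _ _).trans (by gcongr; exact B.two.le_opNorm _)
    _ = _ := by ring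

theorem norm_eq_norm_one_of_mem_RAlg {B : EndPair M} (hB : B ∈ RAlg M) : ‖B‖ = ‖B.one‖ :=
  max_eq_left (norm_one_le_two_of_mem_RAlg (inv_mem_R hB))

/-- The C*-identity: `‖B₁ z‖ ^ 3 = ‖[B₂ B₁ z, z, B₁ z]‖`. -/
theorem sq_norm_one_le_of_mem_RAlg {B : EndPair M} (hB : B ∈ RAlg M) :
    ‖B.one‖ ^ 2 ≤ ‖B.two ∘L B.one‖ := by
  refine sq_opNorm_le_bound (norm_nonneg _) fun z => ?_
  refine sq_norm_le_of_norm_triple_self_le (by positivity) ?_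
  rw [R_mid' hB]
  calc _ ≤ ‖B.two ∘L B.one‖ * ‖z‖ * ‖z‖ * ‖B.one z‖ :=
        (norm_triple_le _ _ _).trans (by gcongr; exact (B.two ∘L B.one).le_opNorm z)
    _ = _ := by ring

namespace StdEmb

theorem norm_toLp_le (x : M) (C : RAlg M) :
    ‖(WithLp.toLp 2 (x, C) : RepSpace M)‖ ≤ ‖x‖ + ‖C‖ := by
  rw [WithLp.prod_norm_eq_of_L2]
  exact Real.sqrt_le_iff.2 ⟨by positivity, by
    change ‖x‖ ^ 2 + ‖C‖ ^ 2 ≤ _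
    nlinarith [norm_nonneg x, norm_nonneg C, mul_nonneg (norm_nonneg x) (norm_nonneg C)]⟩

theorem norm_rep_fst_le (a : StdEmb M) (f : M) (B : RAlg M) :
    ‖a.ul.1.one f + B.1.one a.ur‖ ≤ ‖a‖ * (‖f‖ + ‖B‖) :=
  (WithLp.norm_fst_le _ (rep a (WithLp.toLp 2 (f, B)))).trans
    (((rep a).le_opNorm _).trans (mul_le_mul_of_nonneg_left (norm_toLp_le f B) (norm_nonneg _)))

theorem norm_rep_snd_le (a : StdEmb M) (f : M) (B : RAlg M) :
    ‖arr (conj.symm a.ll) f + Rmul a.lr B‖ ≤ ‖a‖ * (‖f‖ + ‖B‖) :=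
  (WithLp.norm_snd_le _ (rep a (WithLp.toLp 2 (f, B)))).trans
    (((rep a).le_opNorm _).trans (mul_le_mul_of_nonneg_left (norm_toLp_le f B) (norm_nonneg _)))

theorem norm_ul_le (a : StdEmb M) : ‖a.ul‖ ≤ ‖a‖ := by
  have h : ‖a.ul‖ = ‖a.ul.1.one‖ :=
    max_eq_left (norm_two_le_one_of_mem_adjointable (mem_adjointable_of_mem_LAlg a.ul.2))
  rw [h]
  refine a.ul.1.one.opNorm_le_bound (norm_nonneg _) fun f => ?_
  simpa using norm_rep_fst_le a f 0

/-- Apply `π(a)` to `(0, r(f, f))`, where `f` is the upper right entry of `a`. -/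
theorem norm_ur_le (a : StdEmb M) : ‖a.ur‖ ≤ ‖a‖ := by
  refine norm_le_of_norm_triple_self_le (norm_nonneg _) ?_
  have h := norm_rep_fst_le a 0 (arr a.ur a.ur)
  have h' : ‖arr a.ur a.ur‖ ≤ ‖a.ur‖ * ‖a.ur‖ := norm_arrPair_le _ _
  simp only [map_zero, zero_add, norm_zero] at h
  refine h.trans ?_
  rw [sq]
  gcongr

/-- Apply `π(a)` to `(g, 0)`, where `ḡ` is the lower left entry of `a`. -/
theorem norm_ll_le (a : StdEmb M) : ‖a.ll‖ ≤ ‖a‖ := by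
  set g : M := conj.symm a.ll
  change ‖g‖ ≤ ‖a‖
  refine norm_le_of_norm_triple_self_le (norm_nonneg _) ?_
  have h := norm_rep_snd_le a g 0
  have h0 : Rmul a.lr 0 = 0 := (RmulCLM a.lr).map_zero
  rw [h0, add_zero, norm_zero, add_zero] at h
  have h' : ‖triple g g g‖ ≤ ‖arr g g‖ * ‖g‖ :=
    ((arrPair g g).one.le_opNorm g).trans
      (mul_le_mul_of_nonneg_right (EndPair.norm_one_le _) (norm_nonneg _))
  calc _ ≤ ‖arr g g‖ * ‖g‖ := h'
    _ ≤ ‖a‖ * ‖g‖ * ‖g‖ := by gcongr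
    _ = _ := by ring

/-- Apply `π(a)` to `(0, B̄)`, where `B` is the lower right entry of `a`. -/
theorem norm_lr_le (a : StdEmb M) : ‖a.lr‖ ≤ ‖a‖ := by
  have h := norm_rep_snd_le a 0 (Rinv a.lr)
  have h0 : arr (conj.symm a.ll) (0 : M) = 0 := (arrCLM (conj.symm a.ll)).map_zero
  have h1 : ‖Rinv a.lr‖ = ‖a.lr‖ := max_comm _ _
  rw [h0, zero_add, norm_zero, zero_add, h1] at h
  have h2 : ‖a.lr‖ ^ 2 ≤ ‖a‖ * ‖a.lr‖ := by
    have e : ‖a.lr‖ = ‖a.lr.1.one‖ := norm_eq_norm_one_of_mem_RAlg a.lr.2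
    calc _ = ‖a.lr.1.one‖ ^ 2 := by rw [e]
      _ ≤ ‖a.lr.1.two ∘L a.lr.1.one‖ := sq_norm_one_le_of_mem_RAlg a.lr.2
      _ ≤ ‖Rmul a.lr (Rinv a.lr)‖ := EndPair.norm_one_le (Rmul a.lr (Rinv a.lr)).1
      _ ≤ _ := h
  rcases (norm_nonneg a.lr).eq_or_lt with h3 | h3
  · rw [← h3]; exact norm_nonneg _
  · exact le_of_mul_le_mul_right (by linarith) h3

theorem norm_le_add (a : StdEmb M) : ‖a‖ ≤ ‖a.ul‖ + ‖a.ur‖ + ‖a.ll‖ + ‖a.lr‖ := by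
  refine (rep a).opNorm_le_bound (by positivity) fun v => ?_
  refine (norm_toLp_le (a.ul.1.one v.fst + v.snd.1.one a.ur)
    (arr (conj.symm a.ll) v.fst + Rmul a.lr v.snd)).trans ?_
  have hf := WithLp.norm_fst_le _ v
  have hB := WithLp.norm_snd_le _ v
  have h1 : ‖a.ul.1.one v.fst‖ ≤ ‖a.ul‖ * ‖v‖ := (a.ul.1.one.le_opNorm _).trans
    (mul_le_mul (EndPair.norm_one_le _) hf (norm_nonneg _) (norm_nonneg _))
  have h2 : ‖v.snd.1.one a.ur‖ ≤ ‖a.ur‖ * ‖v‖ := by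
    refine (v.snd.1.one.le_opNorm _).trans ?_
    rw [mul_comm]
    exact mul_le_mul_of_nonneg_left ((EndPair.norm_one_le _).trans hB) (norm_nonneg _)
  have h3 : ‖arr (conj.symm a.ll) v.fst‖ ≤ ‖a.ll‖ * ‖v‖ := (norm_arrPair_le _ _).trans
    (mul_le_mul_of_nonneg_left hf (norm_nonneg _))
  have h4 : ‖Rmul a.lr v.snd‖ ≤ ‖a.lr‖ * ‖v‖ :=
    (EndPair.norm_mul_le v.snd.1 a.lr.1).trans (by
      rw [mul_comm]; exact mul_le_mul_of_nonneg_left hB (norm_nonneg _))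
  linarith [norm_add_le (a.ul.1.one v.fst) (v.snd.1.one a.ur),
    norm_add_le (arr (conj.symm a.ll) v.fst) (Rmul a.lr v.snd)]

theorem continuous_ul : Continuous (ul : StdEmb M → LAlg M) :=
  AddMonoidHomClass.continuous_of_bound
    ({ toFun := ul, map_zero' := rfl, map_add' := fun _ _ => rfl } : StdEmb M →+ LAlg M) 1
    fun a => (norm_ul_le a).trans_eq (one_mul _).symm

theorem continuous_ur : Continuous (ur : StdEmb M → M) :=
  AddMonoidHomClass.continuous_of_bound
    ({ toFun := ur, map_zero' := rfl, map_add' := fun _ _ => rfl } : StdEmb M →+ M) 1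
    fun a => (norm_ur_le a).trans_eq (one_mul _).symm

theorem continuous_ll : Continuous (ll : StdEmb M → ConjSpace M) :=
  AddMonoidHomClass.continuous_of_bound
    ({ toFun := ll, map_zero' := rfl, map_add' := fun _ _ => rfl } : StdEmb M →+ ConjSpace M) 1
    fun a => (norm_ll_le a).trans_eq (one_mul _).symm

theorem continuous_lr : Continuous (lr : StdEmb M → RAlg M) :=
  AddMonoidHomClass.continuous_of_bound
    ({ toFun := lr, map_zero' := rfl, map_add' := fun _ _ => rfl } : StdEmb M →+ RAlg M) 1
    fun a => (norm_lr_le a).trans_eq (one_mul _).symm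

end StdEmb

/-! ### Extension of operators from a closed ideal -/

/-- A closed linear relation `G` between Banach spaces that is norm-decreasing and whose domain
contains `s` is defined on the closed span of `s`: its projection to the first factor is bounded
below, so the domain is closed. -/
theorem exists_mem_graph_of_mem_closure_span {X Y : Type*} [NormedAddCommGroup X]
    [NormedSpace ℂ X] [CompleteSpace X] [NormedAddCommGroup Y] [NormedSpace ℂ Y] [CompleteSpace Y]
    (G : Submodule ℂ (X × Y)) (hG : IsClosed (G : Set (X × Y))) (hn : ∀ p ∈ G, ‖p.2‖ ≤ ‖p.1‖)
    {s : Set X} (hs : ∀ x ∈ s, ∃ y, (x, y) ∈ G) {x : X}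
    (hx : x ∈ (Submodule.span ℂ s).topologicalClosure) : ∃ y, (x, y) ∈ G := by
  let π : G →ₗ[ℂ] X := LinearMap.fst ℂ X Y ∘ₗ G.subtype
  have : CompleteSpace G := hG.completeSpace_coe
  have hπ : AntilipschitzWith 1 π := AddMonoidHomClass.antilipschitz_of_bound π fun p => by
    change max ‖p.1.1‖ ‖p.1.2‖ ≤ (1 : ℝ) * ‖p.1.1‖
    rw [one_mul]
    exact max_le le_rfl (hn _ p.2)
  have hc : IsClosed (LinearMap.range π : Set X) := by
    refine hπ.isClosed_range (f := π) ?_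
    exact uniformContinuous_fst.comp uniformContinuous_subtype_val
  have hle : Submodule.span ℂ s ≤ LinearMap.range π := Submodule.span_le.2 fun x hx => by
    obtain ⟨y, hy⟩ := hs x hx
    exact ⟨⟨(x, y), hy⟩, rfl⟩
  obtain ⟨p, rfl⟩ := Submodule.topologicalClosure_minimal _ hle hc hx
  exact ⟨p.1.2, p.2⟩

variable {I : ClosedTernaryIdeal M}

/-- `A ∈ E(M)` extends `B ∈ E(I)`: both components of `A` restrict to those of `B` on `I`. -/
def Extends (B : EndPair I.toSubmodule) (A : EndPair M) : Prop :=
  ∀ z : I.toSubmodule, (B.one z : M) = A.one z ∧ (B.two z : M) = A.two z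

theorem Extends.norm_le {B : EndPair I.toSubmodule} {A : EndPair M} (h : Extends B A) :
    ‖B‖ ≤ ‖A‖ := by
  refine max_le ?_ ?_
  · refine ContinuousLinearMap.opNorm_le_bound B.one (norm_nonneg _) fun z => ?_
    change ‖(B.one z : M)‖ ≤ _
    rw [(h z).1]
    exact A.one.le_of_opNorm_le A.norm_one_le _
  · refine ContinuousLinearMap.opNorm_le_bound B.two (norm_nonneg _) fun z => ?_
    change ‖(B.two z : M)‖ ≤ _
    rw [(h z).2]
    exact A.two.le_of_opNorm_le A.norm_two_le _

variable (I) in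
/-- The pairs `(B, A)` in which `B` is in the closed span of `s`, `A` is in the closed span of `t`
and `A` extends `B`. -/
def extGraph (s : Set (EndPair I.toSubmodule)) (t : Set (EndPair M)) :
    Submodule ℂ (EndPair I.toSubmodule × EndPair M) where
  carrier := {p | p.1 ∈ (Submodule.span ℂ s).topologicalClosure ∧
    p.2 ∈ (Submodule.span ℂ t).topologicalClosure ∧ Extends p.1 p.2}
  zero_mem' := ⟨zero_mem _, zero_mem _, fun _ => ⟨rfl, rfl⟩⟩
  add_mem' hp hq := ⟨add_mem hp.1 hq.1, add_mem hp.2.1 hq.2.1, fun z =>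
    ⟨congrArg₂ (· + ·) (hp.2.2 z).1 (hq.2.2 z).1, congrArg₂ (· + ·) (hp.2.2 z).2 (hq.2.2 z).2⟩⟩
  smul_mem' c _ hp := ⟨Submodule.smul_mem _ c hp.1, Submodule.smul_mem _ c hp.2.1, fun z =>
    ⟨congrArg (c • ·) (hp.2.2 z).1, congrArg (starRingEnd ℂ c • ·) (hp.2.2 z).2⟩⟩

theorem isClosed_extGraph (s : Set (EndPair I.toSubmodule)) (t : Set (EndPair M)) :
    IsClosed (extGraph I s t : Set (EndPair I.toSubmodule × EndPair M)) := by
  refine .inter ((Submodule.isClosed_topologicalClosure _).preimage continuous_fst)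
    (.inter ((Submodule.isClosed_topologicalClosure _).preimage continuous_snd) ?_)
  have h : {p : EndPair I.toSubmodule × EndPair M | Extends p.1 p.2} = ⋂ z : I.toSubmodule,
      {p | (p.1.one z : M) = p.2.one z} ∩ {p | (p.1.two z : M) = p.2.two z} := by
    ext p
    simp only [Set.mem_iInter]
    rfl
  change IsClosed {p : EndPair I.toSubmodule × EndPair M | Extends p.1 p.2}
  rw [h]
  refine isClosed_iInter fun z => .inter ?_ ?_
  · exact isClosed_eq (continuous_subtype_val.comp
      ((EndPair.continuous_one_apply z).comp continuous_fst))
      ((EndPair.continuous_one_apply _).comp continuous_snd)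
  · exact isClosed_eq (continuous_subtype_val.comp
      ((EndPair.continuous_two_apply z).comp continuous_fst))
      ((EndPair.continuous_two_apply _).comp continuous_snd)

/-- If generators `s` and `t` correspond to each other under extension, and extension does not
increase norms on the closed span of `t`, then extension is an isomorphism of the closed span of `s`
onto that of `t`: both projections of `extGraph` are bijective. -/
theorem exists_linearEquiv_extends {s : Set (EndPair I.toSubmodule)} {t : Set (EndPair M)}
    (hn : ∀ (B : EndPair I.toSubmodule) (A : EndPair M),
      A ∈ (Submodule.span ℂ t).topologicalClosure → Extends B A → ‖A‖ ≤ ‖B‖)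
    (hs : ∀ B ∈ s, ∃ A ∈ t, Extends B A) (ht : ∀ A ∈ t, ∃ B ∈ s, Extends B A) :
    ∃ e : (Submodule.span ℂ s).topologicalClosure ≃ₗ[ℂ] (Submodule.span ℂ t).topologicalClosure,
      ∀ B, Extends B.1 (e B).1 := by
  have : CompleteSpace M := CStarTernaryRing.toCompleteSpace
  have : CompleteSpace I.toSubmodule := CStarTernaryRing.toCompleteSpace
  set G := extGraph I s t
  have hG := isClosed_extGraph (I := I) s t
  have hmem : ∀ {B A}, B ∈ s → A ∈ t → Extends B A → (B, A) ∈ G := fun hB hA h =>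
    ⟨Submodule.le_topologicalClosure _ (Submodule.subset_span hB),
      Submodule.le_topologicalClosure _ (Submodule.subset_span hA), h⟩
  let π₁ : G →ₗ[ℂ] (Submodule.span ℂ s).topologicalClosure :=
    (LinearMap.fst ℂ _ _ ∘ₗ G.subtype).codRestrict _ fun p => p.2.1
  let π₂ : G →ₗ[ℂ] (Submodule.span ℂ t).topologicalClosure :=
    (LinearMap.snd ℂ _ _ ∘ₗ G.subtype).codRestrict _ fun p => p.2.2.1
  have h₁ : Function.Bijective π₁ := by
    refine ⟨(injective_iff_map_eq_zero _).2 fun p hp => ?_, fun B => ?_⟩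
    · have hp₁ : p.1.1 = 0 := congrArg Subtype.val hp
      have hp₂ := hn _ _ p.2.2.1 p.2.2.2
      rw [hp₁, norm_zero] at hp₂
      exact Subtype.ext (Prod.ext hp₁ (norm_le_zero_iff.1 hp₂))
    · obtain ⟨A, hA⟩ := exists_mem_graph_of_mem_closure_span G hG
        (fun p hp => hn _ _ hp.2.1 hp.2.2)
        (fun B hB => (hs B hB).imp fun A hA => hmem hB hA.1 hA.2) B.2
      exact ⟨⟨_, hA⟩, rfl⟩
  have h₂ : Function.Bijective π₂ := by
    refine ⟨(injective_iff_map_eq_zero _).2 fun p hp => ?_, fun A => ?_⟩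
    · have hp₁ : p.1.2 = 0 := congrArg Subtype.val hp
      have hp₂ := p.2.2.2.norm_le
      rw [hp₁, norm_zero] at hp₂
      exact Subtype.ext (Prod.ext (norm_le_zero_iff.1 hp₂) hp₁)
    · obtain ⟨B, hB⟩ := exists_mem_graph_of_mem_closure_span
        (G.comap (LinearEquiv.prodComm ℂ (EndPair M) (EndPair I.toSubmodule)).toLinearMap)
        (hG.preimage continuous_swap) (fun p hp => hp.2.2.norm_le)
        (fun A hA => (ht A hA).imp fun B hB => hmem hB.1 hA hB.2) A.2
      exact ⟨⟨_, hB⟩, rfl⟩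
  refine ⟨(LinearEquiv.ofBijective π₁ h₁).symm.trans (LinearEquiv.ofBijective π₂ h₂), fun B => ?_⟩
  obtain ⟨p, rfl⟩ := (LinearEquiv.ofBijective π₁ h₁).surjective B
  rw [LinearEquiv.trans_apply, LinearEquiv.symm_apply_apply]
  exact p.2.2.2

theorem Extends.sub {B B' : EndPair I.toSubmodule} {A A' : EndPair M} (h : Extends B A)
    (h' : Extends B' A') : Extends (B - B') (A - A') := fun z =>
  ⟨congrArg₂ (· - ·) (h z).1 (h' z).1, congrArg₂ (· - ·) (h z).2 (h' z).2⟩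

theorem Extends.mul {B B' : EndPair I.toSubmodule} {A A' : EndPair M} (h : Extends B A)
    (h' : Extends B' A') : Extends (B.mul B') (A.mul A') := fun z =>
  ⟨((h _).1.trans (congrArg A.one (h' z).1)), ((h' _).2.trans (congrArg A'.two (h z).2))⟩

theorem Extends.inv {B : EndPair I.toSubmodule} {A : EndPair M} (h : Extends B A) :
    Extends B.inv A.inv := fun z => (h z).symm

theorem extends_ellPair (x y : I.toSubmodule) :
    Extends (ellPair x y) (ellPair (x : M) (y : M)) := fun _ => ⟨rfl, rfl⟩

theorem extends_arrPair (x y : I.toSubmodule) :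
    Extends (arrPair x y) (arrPair (x : M) (y : M)) := fun _ => ⟨rfl, rfl⟩

/-! ### The closed ideals of `L(M)` and `R(M)` generated by an ideal -/

variable (I) in
/-- The closed linear span in `L(M)` of the elements `ℓ(x, y)` with `x, y ∈ I`. -/
def idealL : Submodule ℂ (EndPair M) :=
  (Submodule.span ℂ {A | ∃ x y : I.toSubmodule, A = ellPair (x : M) (y : M)}).topologicalClosure

variable (I) in
/-- The closed linear span in `R(M)` of the elements `r(x, y)` with `x, y ∈ I`. -/
def idealR : Submodule ℂ (EndPair M) :=
  (Submodule.span ℂ {A | ∃ x y : I.toSubmodule, A = arrPair (x : M) (y : M)}).topologicalClosure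

theorem ellPair_mem_idealL (x y : I.toSubmodule) : ellPair (x : M) (y : M) ∈ idealL I :=
  Submodule.le_topologicalClosure _ (Submodule.subset_span ⟨x, y, rfl⟩)

theorem arrPair_mem_idealR (x y : I.toSubmodule) : arrPair (x : M) (y : M) ∈ idealR I :=
  Submodule.le_topologicalClosure _ (Submodule.subset_span ⟨x, y, rfl⟩)

theorem isClosed_idealL : IsClosed (idealL I : Set (EndPair M)) :=
  Submodule.isClosed_topologicalClosure _

theorem isClosed_idealR : IsClosed (idealR I : Set (EndPair M)) :=
  Submodule.isClosed_topologicalClosure _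

theorem idealL_le : idealL I ≤ LAlg M :=
  Submodule.topologicalClosure_mono (Submodule.span_mono fun _ ⟨x, y, h⟩ => ⟨x, y, h⟩)

theorem idealR_le : idealR I ≤ RAlg M :=
  Submodule.topologicalClosure_mono (Submodule.span_mono fun _ ⟨x, y, h⟩ => ⟨x, y, h⟩)

theorem inv_mem_idealL {A : EndPair M} (hA : A ∈ idealL I) : A.inv ∈ idealL I := by
  refine EndPair.closure_span_induction (p := fun A => star A ∈ idealL I) ?_ ?_ ?_ ?_ ?_ hA
  · rintro _ ⟨x, y, rfl⟩; exact ellPair_mem_idealL y x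
  · rw [star_zero]; exact zero_mem _
  · intro A B hA hB; rw [star_add]; exact add_mem hA hB
  · intro c A hA; rw [star_smul]; exact Submodule.smul_mem _ _ hA
  · exact isClosed_idealL.preimage EndPair.continuous_inv

theorem inv_mem_idealR {A : EndPair M} (hA : A ∈ idealR I) : A.inv ∈ idealR I := by
  refine EndPair.closure_span_induction (p := fun A => star A ∈ idealR I) ?_ ?_ ?_ ?_ ?_ hA
  · rintro _ ⟨x, y, rfl⟩; exact arrPair_mem_idealR y x
  · rw [star_zero]; exact zero_mem _
  · intro A B hA hB; rw [star_add]; exact add_mem hA hB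
  · intro c A hA; rw [star_smul]; exact Submodule.smul_mem _ _ hA
  · exact isClosed_idealR.preimage EndPair.continuous_inv

theorem one_mem_of_mem_LAlg {A : EndPair M} (hA : A ∈ LAlg M) {x : M} (hx : x ∈ I.toSubmodule) :
    A.one x ∈ I.toSubmodule := by
  refine EndPair.closure_span_induction (p := fun A => A.one x ∈ I.toSubmodule) ?_ ?_ ?_ ?_ ?_ hA
  · rintro _ ⟨a, b, rfl⟩; exact I.triple_right_mem a b x hx
  · exact zero_mem _
  · intro A B hA hB; exact add_mem hA hB
  · intro c A hA; exact Submodule.smul_mem _ c hA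
  · exact I.isClosed.preimage (EndPair.continuous_one_apply x)

theorem one_mem_of_mem_RAlg {A : EndPair M} (hA : A ∈ RAlg M) {x : M} (hx : x ∈ I.toSubmodule) :
    A.one x ∈ I.toSubmodule := by
  refine EndPair.closure_span_induction (p := fun A => A.one x ∈ I.toSubmodule) ?_ ?_ ?_ ?_ ?_ hA
  · rintro _ ⟨a, b, rfl⟩; exact I.triple_left_mem x hx a b
  · exact zero_mem _
  · intro A B hA hB; exact add_mem hA hB
  · intro c A hA; exact Submodule.smul_mem _ c hA
  · exact I.isClosed.preimage (EndPair.continuous_one_apply x)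

theorem one_mem_of_mem_idealL {A : EndPair M} (hA : A ∈ idealL I) (x : M) :
    A.one x ∈ I.toSubmodule := by
  refine EndPair.closure_span_induction (p := fun A => A.one x ∈ I.toSubmodule) ?_ ?_ ?_ ?_ ?_ hA
  · rintro _ ⟨a, b, rfl⟩; exact I.triple_left_mem a a.2 b x
  · exact zero_mem _
  · intro A B hA hB; exact add_mem hA hB
  · intro c A hA; exact Submodule.smul_mem _ c hA
  · exact I.isClosed.preimage (EndPair.continuous_one_apply x)

theorem one_mem_of_mem_idealR {A : EndPair M} (hA : A ∈ idealR I) (x : M) :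
    A.one x ∈ I.toSubmodule := by
  refine EndPair.closure_span_induction (p := fun A => A.one x ∈ I.toSubmodule) ?_ ?_ ?_ ?_ ?_ hA
  · rintro _ ⟨a, b, rfl⟩; exact I.triple_right_mem x a b b.2
  · exact zero_mem _
  · intro A B hA hB; exact add_mem hA hB
  · intro c A hA; exact Submodule.smul_mem _ c hA
  · exact I.isClosed.preimage (EndPair.continuous_one_apply x)

theorem mul_mem_idealL {A B : EndPair M} (hA : A ∈ LAlg M) (hB : B ∈ idealL I) :
    A.mul B ∈ idealL I := by
  refine EndPair.closure_span_induction (p := fun B => A * B ∈ idealL I) ?_ ?_ ?_ ?_ ?_ hB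
  · rintro _ ⟨x, y, rfl⟩
    change A.mul _ ∈ _
    rw [mul_ellPair hA]
    exact ellPair_mem_idealL ⟨_, one_mem_of_mem_LAlg hA x.2⟩ y
  · rw [mul_zero]; exact zero_mem _
  · intro B C hB hC; rw [mul_add]; exact add_mem hB hC
  · intro c B hB; rw [mul_smul_comm]; exact Submodule.smul_mem _ c hB
  · exact isClosed_idealL.preimage (EndPair.continuous_mul_left A)

theorem mul_mem_idealR {A B : EndPair M} (hA : A ∈ RAlg M) (hB : B ∈ idealR I) :
    A.mul B ∈ idealR I := by
  refine EndPair.closure_span_induction (p := fun B => A * B ∈ idealR I) ?_ ?_ ?_ ?_ ?_ hB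
  · rintro _ ⟨x, y, rfl⟩
    change A.mul _ ∈ _
    rw [mul_arrPair hA]
    exact arrPair_mem_idealR x ⟨_, one_mem_of_mem_RAlg hA y.2⟩
  · rw [mul_zero]; exact zero_mem _
  · intro B C hB hC; rw [mul_add]; exact add_mem hB hC
  · intro c B hB; rw [mul_smul_comm]; exact Submodule.smul_mem _ c hB
  · exact isClosed_idealR.preimage (EndPair.continuous_mul_left A)

theorem mul_mem_idealR_right {A B : EndPair M} (hA : A ∈ RAlg M) (hB : B ∈ idealR I) :
    B.mul A ∈ idealR I :=
  inv_mem_idealR (mul_mem_idealR (inv_mem_R hA) (inv_mem_idealR hB))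

/-- For `w = A₁ z ∈ I` one has `[w w w] = A₁ [z w w] = B₁ [z w w]`, since `[z w w] ∈ I`. -/
theorem norm_one_le_of_extends_idealL {B : EndPair I.toSubmodule} {A : EndPair M}
    (hA : A ∈ idealL I) (h : Extends B A) : ‖A.one‖ ≤ ‖B.one‖ := by
  refine A.one.opNorm_le_bound (norm_nonneg _) fun z => ?_
  refine norm_le_of_norm_triple_self_le (by positivity) ?_
  set w := A.one z
  have hw : w ∈ I.toSubmodule := one_mem_of_mem_idealL hA z
  have e : triple w w w = B.one ⟨triple z w w, I.triple_right_mem z w w hw⟩ :=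
    ((h _).1.trans (L_one_triple (idealL_le hA) z w w)).symm
  rw [e]
  refine (B.one.le_opNorm ⟨triple z w w, I.triple_right_mem z w w hw⟩).trans ?_
  rw [mul_assoc]
  refine mul_le_mul_of_nonneg_left ((norm_triple_le z w w).trans_eq (by ring)) (norm_nonneg _)

theorem norm_le_of_extends_idealL {B : EndPair I.toSubmodule} {A : EndPair M}
    (hA : A ∈ idealL I) (h : Extends B A) : ‖A‖ ≤ ‖B‖ :=
  max_le ((norm_one_le_of_extends_idealL hA h).trans B.norm_one_le)
    ((norm_one_le_of_extends_idealL (inv_mem_idealL hA) h.inv).trans B.norm_two_le)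

/-- For `w = A₁ z ∈ I` one has `[w w w] = A₁ [w w z] = B₁ [w w z]`, since `[w w z] ∈ I`. -/
theorem norm_one_le_of_extends_idealR {B : EndPair I.toSubmodule} {A : EndPair M}
    (hA : A ∈ idealR I) (h : Extends B A) : ‖A.one‖ ≤ ‖B.one‖ := by
  refine A.one.opNorm_le_bound (norm_nonneg _) fun z => ?_
  refine norm_le_of_norm_triple_self_le (by positivity) ?_
  set w := A.one z
  have hw : w ∈ I.toSubmodule := one_mem_of_mem_idealR hA z
  have e : triple w w w = B.one ⟨triple w w z, I.triple_left_mem w hw w z⟩ :=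
    ((h _).1.trans (R_one_triple (idealR_le hA) w w z)).symm
  rw [e]
  refine (B.one.le_opNorm ⟨triple w w z, I.triple_left_mem w hw w z⟩).trans ?_
  rw [mul_assoc]
  refine mul_le_mul_of_nonneg_left ((norm_triple_le w w z).trans_eq (by ring)) (norm_nonneg _)

theorem norm_le_of_extends_idealR {B : EndPair I.toSubmodule} {A : EndPair M}
    (hA : A ∈ idealR I) (h : Extends B A) : ‖A‖ ≤ ‖B‖ :=
  max_le ((norm_one_le_of_extends_idealR hA h).trans B.norm_one_le)
    ((norm_one_le_of_extends_idealR (inv_mem_idealR hA) h.inv).trans B.norm_two_le)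

theorem eq_of_extends_idealL {B : EndPair I.toSubmodule} {A A' : EndPair M}
    (hA : A ∈ idealL I) (hA' : A' ∈ idealL I) (h : Extends B A) (h' : Extends B A') : A = A' := by
  have := norm_le_of_extends_idealL (sub_mem hA hA') (h.sub h')
  rwa [sub_self, norm_zero, norm_le_zero_iff, sub_eq_zero] at this

theorem eq_of_extends_idealR {B : EndPair I.toSubmodule} {A A' : EndPair M}
    (hA : A ∈ idealR I) (hA' : A' ∈ idealR I) (h : Extends B A) (h' : Extends B A') : A = A' := by
  have := norm_le_of_extends_idealR (sub_mem hA hA') (h.sub h')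
  rwa [sub_self, norm_zero, norm_le_zero_iff, sub_eq_zero] at this

variable (I) in
theorem exists_extL : ∃ e : LAlg I.toSubmodule ≃ₗ[ℂ] idealL I, ∀ B, Extends B.1 (e B).1 :=
  exists_linearEquiv_extends (fun _ _ hA h => norm_le_of_extends_idealL hA h)
    (by rintro _ ⟨x, y, rfl⟩; exact ⟨_, ⟨x, y, rfl⟩, extends_ellPair x y⟩)
    (by rintro _ ⟨x, y, rfl⟩; exact ⟨_, ⟨x, y, rfl⟩, extends_ellPair x y⟩)

variable (I) in
theorem exists_extR : ∃ e : RAlg I.toSubmodule ≃ₗ[ℂ] idealR I, ∀ B, Extends B.1 (e B).1 :=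
  exists_linearEquiv_extends (fun _ _ hA h => norm_le_of_extends_idealR hA h)
    (by rintro _ ⟨x, y, rfl⟩; exact ⟨_, ⟨x, y, rfl⟩, extends_arrPair x y⟩)
    (by rintro _ ⟨x, y, rfl⟩; exact ⟨_, ⟨x, y, rfl⟩, extends_arrPair x y⟩)

theorem mem_closure_triple_of_mem_ideal {x : M} (hx : x ∈ I.toSubmodule) :
    x ∈ closure {y : M | ∃ v ∈ I.toSubmodule, y = triple x x v} := by
  have h := mem_closure_triple_self (⟨x, hx⟩ : I.toSubmodule)
  have h' := image_closure_subset_closure_image continuous_subtype_val ⟨_, h, rfl⟩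
  refine closure_mono ?_ h'
  rintro _ ⟨_, ⟨v, rfl⟩, rfl⟩
  exact ⟨v, v.2, rfl⟩

/-- It suffices to treat `ℓ(y, x) = ℓ(x, y)‾`; replacing `y` by `[y y v]` gives
`ℓ([y y v], x) = ℓ(y, [x v y])`, whose arguments are both in `I`. -/
theorem ellPair_mem_idealL_of_right (x : M) {y : M} (hy : y ∈ I.toSubmodule) :
    ellPair x y ∈ idealL I := by
  have hc : Continuous fun y : M => ellPair y x :=
    AddMonoidHomClass.continuous_of_bound (AddMonoidHom.mk' (fun y : M => ellPair y x)
      fun y y' => EndPair.ext (fun z => by simp [triple_add_left])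
        (fun z => by simp [triple_add_mid])) ‖x‖
      fun y => max_le ((norm_opL_le y x).trans_eq (mul_comm _ _)) (norm_opL_le x y)
  refine inv_mem_idealL (A := ellPair y x) (closure_minimal (t := {y | ellPair y x ∈ idealL I})
    ?_ (isClosed_idealL.preimage hc) (mem_closure_triple_of_mem_ideal hy))
  rintro _ ⟨v, hv, rfl⟩
  have e : ellPair (triple y y v) x = ellPair y (triple x v y) :=
    EndPair.ext (fun z => triple_assoc_mid y y v x z) (fun z => (triple_assoc_mid x v y y z).symm)
  change ellPair (triple y y v) x ∈ idealL I
  rw [e]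
  exact ellPair_mem_idealL ⟨y, hy⟩ ⟨_, I.triple_right_mem x v y hy⟩

/-- Replacing `y` by `[y y v]` gives `r(x, [y y v]) = r([y y x], v)`, whose arguments are both
in `I`. -/
theorem arrPair_mem_idealR_of_right (x : M) {y : M} (hy : y ∈ I.toSubmodule) :
    arrPair x y ∈ idealR I := by
  refine closure_minimal (t := {y | arrPair x y ∈ idealR I}) ?_ (isClosed_idealR.preimage
    (continuous_subtype_val.comp (StdEmb.arrCLM x).continuous)) (mem_closure_triple_of_mem_ideal hy)
  rintro _ ⟨v, hv, rfl⟩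
  have e : arrPair x (triple y y v) = arrPair (triple y y x) v := arrPair_one (ellPair_mem y y) x v
  change arrPair x (triple y y v) ∈ idealR I
  rw [e]
  exact arrPair_mem_idealR ⟨_, I.triple_left_mem y hy y x⟩ ⟨v, hv⟩

/-! ### The *-homomorphism between the standard embeddings -/

variable (I) in
/-- The isometric embedding of `L(I)` in `L(M)` that extends operators from `I` to `M`. -/
def extL : LAlg I.toSubmodule →ₗ[ℂ] LAlg M :=
  Submodule.inclusion idealL_le ∘ₗ (exists_extL I).choose.toLinearMap

theorem extL_mem (B : LAlg I.toSubmodule) : (extL I B).1 ∈ idealL I :=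
  ((exists_extL I).choose B).2

theorem extends_extL (B : LAlg I.toSubmodule) : Extends B.1 (extL I B).1 :=
  (exists_extL I).choose_spec B

theorem exists_extL_eq {A : LAlg M} (hA : A.1 ∈ idealL I) : ∃ B, extL I B = A := by
  obtain ⟨B, hB⟩ := (exists_extL I).choose.surjective ⟨A.1, hA⟩
  refine ⟨B, Subtype.ext ?_⟩
  change ((exists_extL I).choose B).1 = A.1
  rw [hB]

theorem extL_eq {B : LAlg I.toSubmodule} {A : LAlg M} (hA : A.1 ∈ idealL I)
    (h : Extends B.1 A.1) : extL I B = A :=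
  Subtype.ext (eq_of_extends_idealL (extL_mem B) hA (extends_extL B) h)

theorem norm_extL (B : LAlg I.toSubmodule) : ‖extL I B‖ = ‖B‖ :=
  (norm_le_of_extends_idealL (extL_mem B) (extends_extL B)).antisymm (extends_extL B).norm_le

theorem extL_ell (x y : I.toSubmodule) : extL I (ell x y) = ell (x : M) (y : M) :=
  extL_eq (ellPair_mem_idealL x y) (extends_ellPair x y)

theorem extL_mul (B B' : LAlg I.toSubmodule) :
    extL I (Lmul B B') = Lmul (extL I B) (extL I B') :=
  extL_eq (mul_mem_idealL (extL I B).2 (extL_mem B'))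
    ((extends_extL B).mul (extends_extL B'))

theorem extL_inv (B : LAlg I.toSubmodule) : extL I (Linv B) = Linv (extL I B) :=
  extL_eq (inv_mem_idealL (extL_mem B)) (extends_extL B).inv

variable (I) in
/-- The isometric embedding of `R(I)` in `R(M)` that extends operators from `I` to `M`. -/
def extR : RAlg I.toSubmodule →ₗ[ℂ] RAlg M :=
  Submodule.inclusion idealR_le ∘ₗ (exists_extR I).choose.toLinearMap

theorem extR_mem (B : RAlg I.toSubmodule) : (extR I B).1 ∈ idealR I :=
  ((exists_extR I).choose B).2

theorem extends_extR (B : RAlg I.toSubmodule) : Extends B.1 (extR I B).1 :=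
  (exists_extR I).choose_spec B

theorem exists_extR_eq {A : RAlg M} (hA : A.1 ∈ idealR I) : ∃ B, extR I B = A := by
  obtain ⟨B, hB⟩ := (exists_extR I).choose.surjective ⟨A.1, hA⟩
  refine ⟨B, Subtype.ext ?_⟩
  change ((exists_extR I).choose B).1 = A.1
  rw [hB]

theorem extR_eq {B : RAlg I.toSubmodule} {A : RAlg M} (hA : A.1 ∈ idealR I)
    (h : Extends B.1 A.1) : extR I B = A :=
  Subtype.ext (eq_of_extends_idealR (extR_mem B) hA (extends_extR B) h)

theorem norm_extR (B : RAlg I.toSubmodule) : ‖extR I B‖ = ‖B‖ :=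
  (norm_le_of_extends_idealR (extR_mem B) (extends_extR B)).antisymm (extends_extR B).norm_le

theorem extR_arr (x y : I.toSubmodule) : extR I (arr x y) = arr (x : M) (y : M) :=
  extR_eq (arrPair_mem_idealR x y) (extends_arrPair x y)

theorem extR_mul (B B' : RAlg I.toSubmodule) :
    extR I (Rmul B B') = Rmul (extR I B) (extR I B') :=
  extR_eq (mul_mem_idealR (extR I B').2 (extR_mem B))
    ((extends_extR B').mul (extends_extR B))

theorem extR_inv (B : RAlg I.toSubmodule) : extR I (Rinv B) = Rinv (extR I B) :=
  extR_eq (inv_mem_idealR (extR_mem B)) (extends_extR B).inv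

namespace StdEmb

variable (I) in
/-- The *-homomorphism of standard embeddings `𝒜(I) → 𝒜(M)`: diagonal entries are extended from
`I` to `M`, off-diagonal entries are included in `M`. -/
def ofIdeal : StdEmb I.toSubmodule →⋆ₙₐ[ℂ] StdEmb M where
  toFun a := ⟨extL I a.ul, a.ur, conj ((conj.symm a.ll : I.toSubmodule) : M), extR I a.lr⟩
  map_smul' c a := StdEmb.ext ((extL I).map_smul c a.ul) rfl rfl ((extR I).map_smul c a.lr)
  map_zero' := StdEmb.ext (extL I).map_zero rfl rfl (extR I).map_zero
  map_add' a b :=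
    StdEmb.ext ((extL I).map_add a.ul b.ul) rfl rfl ((extR I).map_add a.lr b.lr)
  map_mul' a b := StdEmb.ext
    (((extL I).map_add _ _).trans (congrArg₂ (· + ·) (extL_mul _ _) (extL_ell _ _)))
    (congrArg₂ (· + ·) (extends_extL a.ul _).1 (extends_extR b.lr _).1)
    (congrArg conj (congrArg₂ (· + ·) (extends_extL b.ul _).2 (extends_extR a.lr _).2))
    (((extR I).map_add _ _).trans (congrArg₂ (· + ·) (extR_arr _ _) (extR_mul _ _)))
  map_star' a := StdEmb.ext (extL_inv a.ul) rfl rfl (extR_inv a.lr)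

theorem mem_range_ofIdeal {a : StdEmb M} : a ∈ Set.range (ofIdeal I) ↔
    (a.ul.1 ∈ idealL I ∧ a.ur ∈ I.toSubmodule) ∧
      conj.symm a.ll ∈ I.toSubmodule ∧ a.lr.1 ∈ idealR I := by
  constructor
  · rintro ⟨b, rfl⟩
    exact ⟨⟨extL_mem b.ul, b.ur.2⟩, (conj.symm b.ll : I.toSubmodule).2, extR_mem b.lr⟩
  · rintro ⟨⟨h₁, h₂⟩, h₃, h₄⟩
    obtain ⟨A, hA⟩ := exists_extL_eq h₁
    obtain ⟨B, hB⟩ := exists_extR_eq h₄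
    exact ⟨⟨A, ⟨_, h₂⟩, conj ⟨_, h₃⟩, B⟩, StdEmb.ext hA rfl rfl hB⟩

theorem isClosed_range_ofIdeal : IsClosed (Set.range (ofIdeal I)) := by
  have h : Set.range (ofIdeal I) = {a | (a.ul.1 ∈ idealL I ∧ a.ur ∈ I.toSubmodule) ∧
      conj.symm a.ll ∈ I.toSubmodule ∧ a.lr.1 ∈ idealR I} := Set.ext fun _ => mem_range_ofIdeal
  rw [h]
  exact ((isClosed_idealL.preimage (continuous_subtype_val.comp continuous_ul)).inter
    (I.isClosed.preimage continuous_ur)).inter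
    ((I.isClosed.preimage ((conj (V := M)).symm.continuous.comp continuous_ll)).inter
    (isClosed_idealR.preimage (continuous_subtype_val.comp continuous_lr)))

theorem mul_mem_range_ofIdeal (a : StdEmb M) {b : StdEmb M} (hb : b ∈ Set.range (ofIdeal I)) :
    a * b ∈ Set.range (ofIdeal I) := by
  rw [mem_range_ofIdeal] at hb ⊢
  obtain ⟨⟨h1, h2⟩, h3, h4⟩ := hb
  refine ⟨⟨add_mem (mul_mem_idealL a.ul.2 h1) (ellPair_mem_idealL_of_right _ h3), ?_⟩, ?_, ?_⟩
  · exact add_mem (one_mem_of_mem_LAlg a.ul.2 h2) (one_mem_of_mem_idealR h4 _)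
  · exact add_mem (one_mem_of_mem_idealL (inv_mem_idealL h1) _)
      (one_mem_of_mem_RAlg (inv_mem_R a.lr.2) h3)
  · exact add_mem (arrPair_mem_idealR_of_right _ h2) (mul_mem_idealR_right a.lr.2 h4)

theorem isEmbedding_ofIdeal : Topology.IsEmbedding (ofIdeal I) := by
  have h₁ : ∀ a, ‖ofIdeal I a‖ ≤ 4 * ‖a‖ := fun a => by
    refine (norm_le_add _).trans ?_
    change ‖extL I a.ul‖ + ‖a.ur‖ + ‖a.ll‖ + ‖extR I a.lr‖ ≤ _
    rw [norm_extL, norm_extR]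
    linarith [norm_ul_le a, norm_ur_le a, norm_ll_le a, norm_lr_le a]
  have h₂ : ∀ a, ‖a‖ ≤ (4 : NNReal) * ‖ofIdeal I a‖ := fun a => by
    have e₁ : ‖a.ul‖ ≤ ‖ofIdeal I a‖ := (norm_extL a.ul).symm.trans_le (norm_ul_le (ofIdeal I a))
    have e₂ : ‖a.ur‖ ≤ ‖ofIdeal I a‖ := norm_ur_le (ofIdeal I a)
    have e₃ : ‖a.ll‖ ≤ ‖ofIdeal I a‖ := norm_ll_le (ofIdeal I a)
    have e₄ : ‖a.lr‖ ≤ ‖ofIdeal I a‖ := (norm_extR a.lr).symm.trans_le (norm_lr_le (ofIdeal I a))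
    refine (norm_le_add a).trans ?_
    rw [NNReal.coe_ofNat]
    linarith
  exact ((AddMonoidHomClass.antilipschitz_of_bound (ofIdeal I) h₂).isUniformEmbedding
    (AddMonoidHomClass.uniformContinuous_of_bound (ofIdeal I) 4 h₁)).isEmbedding

end StdEmb

end CStarTernary

end

theorem mainTheorem9 {M : Type*} [NormedAddCommGroup M] [NormedSpace ℂ M] [CStarTernaryRing M]
    (I : CStarTernary.ClosedTernaryIdeal M) :
    ∃ φ : CStarTernary.StdEmb I.toSubmodule →⋆ₙₐ[ℂ] CStarTernary.StdEmb M,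
      (∀ x y f g u v : I.toSubmodule,
        φ ⟨CStarTernary.ell x y, f, CStarTernary.conj g, CStarTernary.arr u v⟩ =
          ⟨CStarTernary.ell (x : M) (y : M), (f : M), CStarTernary.conj (g : M),
            CStarTernary.arr (u : M) (v : M)⟩) ∧
      Topology.IsEmbedding φ ∧
      IsClosed (Set.range φ) ∧
      (∀ a : CStarTernary.StdEmb M, ∀ b ∈ Set.range φ,
        a * b ∈ Set.range φ ∧ b * a ∈ Set.range φ) := by
  open CStarTernary in
  refine ⟨StdEmb.ofIdeal I, fun x y f g u v => ?_, StdEmb.isEmbedding_ofIdeal,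
    StdEmb.isClosed_range_ofIdeal, fun a b hb => ⟨StdEmb.mul_mem_range_ofIdeal a hb, ?_⟩⟩
  · exact StdEmb.ext (extL_ell x y) rfl rfl (extR_arr u v)
  · have hstar : ∀ c ∈ Set.range (StdEmb.ofIdeal I), star c ∈ Set.range (StdEmb.ofIdeal I) := by
      rintro _ ⟨d, rfl⟩
      exact ⟨star d, map_star _ d⟩
    -- `b a = (a* b*)*`, and the image is closed under the involution.
    have h := hstar _ (StdEmb.mul_mem_range_ofIdeal (star a) (hstar b hb))
    rwa [star_mul, star_star, star_star] at h
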